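/- Identify $\mathbb{R}^2$ with $\mathbb{C}$. A \emph{self-similarly expanding curve} is a regular parametrization, defined on $\mathbb{R}$ and covering the whole curve, of a set of the form $R(\operatorname{graph} u)$, where $R$ is a rotation about the origin and $u:\mathbb{R}\to\mathbb{R}$ is a $C^2$ solution of $$u-xu'=\frac{u''}{1+(u')^2}\quad\text{on }\mathbb{R},\qquad u'(0)=0 .$$ Let $l=\{(x,0):x\ge 0\}$. For $h\in\mathbb{R}$ let $c_h:\mathbb{R}\to\mathbb{R}^2$ denote the self-similarly expanding curve with $\operatorname{dist}(c_h(t),l)\to 0$ as $t\to\infty$ and $\operatorname{dist}(0,\operatorname{Im} c_h)=|h|$, which lies in the open upper half-plane if $h>0$ and in the open lower half-plane if $h<0$ (parametrized regularly in any way compatible with this). \textbf{Lemma.} Let $h_1\ne h_2$ and $h_0$ be real numbers, let $R\neq\mathrm{id}$ be a rotation about the origin, and let $b=R\circ c_{h_0}$. Suppose that $c_{h_1}$ and $c_{h_2}$ intersect $b$ in $p_1=c_{h_1}(s_1)=b(t_1)$ and $p_2=c_{h_2}(s_2)=b(t_2)$, respectively, with $t_1<t_2$. For $i=1,2$ let $\alpha_i\in[0,\pi]$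 be the angle between the tangent vectors $c_{h_i}'(s_i)$ and $b'(t_i)$ at $p_i$. Let $\Gamma=c_{h_1}([s_1,\infty))\cup c_{h_2}([s_2,\infty))\cup b([t_1,t_2])$, and let $A$ be the triangle (with one vertex at infinity) enclosed by $\Gamma$, that is, the set of all points of $\mathbb{R}^2\setminus\Gamma$ whose connected component in $\mathbb{R}^2\setminus\Gamma$ stays within bounded distance of $l$. Then the area $|A|$ is finite and $$\alpha_2-\alpha_1=2\,|A| .$$ -/

import Mathlib

open Set Filter Topology MeasureTheory
open scoped Real

/-- An entire solution of the graphical equation `u - x u' = u'' / (1 + (u')²)` for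
self-similarly expanding curves (at the time at which the homothety factor is `1`). -/
def IsExpanderSolution (u : ℝ → ℝ) : Prop :=
  ContDiff ℝ 2 u ∧
    ∀ x : ℝ, u x - x * deriv u x = deriv (deriv u) x / (1 + (deriv u x) ^ 2)

/-- A (complete) self-similarly expanding curve in the plane `ℝ² = ℂ`: a regular parametrization of
the graph of a solution `u` with `u'(0) = 0`, rotated about the origin. -/
def IsExpandingCurve (c : ℝ → ℂ) : Prop :=
  ∃ (u : ℝ → ℝ) (R : Circle) (φ : ℝ → ℝ),
    IsExpanderSolution u ∧ deriv u 0 = 0 ∧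
    ContDiff ℝ 1 φ ∧ (∀ t, deriv φ t ≠ 0) ∧ Function.Surjective φ ∧
    ∀ t, c t = rotation R ⟨φ t, u (φ t)⟩

/-- The half-line `{(x, 0) : x ≥ 0}`. -/
def halfLine : Set ℂ := {z | 0 ≤ z.re ∧ z.im = 0}

/-- `c` is (a regular parametrization of) the self-similarly expanding curve `c_h` that is asymptotic
to the half-line `{(x, 0) : x ≥ 0}` as `t → ∞`, where `|h|` is the distance of the curve from the
origin, and the sign of `h` tells in which half-plane the curve lies. -/
structure IsExpandingCurveWithParam (h : ℝ) (c : ℝ → ℂ) : Prop where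
  expanding : IsExpandingCurve c
  asymptotic : Tendsto (fun t => Metric.infDist (c t) halfLine) atTop (𝓝 0)
  dist_origin : Metric.infDist 0 (range c) = |h|
  upper : 0 < h → ∀ t, 0 < (c t).im
  lower : h < 0 → ∀ t, (c t).im < 0

/-- The region enclosed by `Γ`, where `Γ` closes up at infinity along the half-line `l`: the points
off `Γ` whose connected component in the complement of `Γ` stays within bounded distance of `l`. -/
def enclosedRegion (l Γ : Set ℂ) : Set ℂ :=
  {p | p ∉ Γ ∧ ∃ r : ℝ, ∀ q ∈ connectedComponentIn Γᶜ p, Metric.infDist q l ≤ r}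

/-- The triangle (with one vertex at infinity) enclosed by the part of `c₁` after `c₁ s₁`, the part
of `c₂` after `c₂ s₂`, and the arc of `b` between `b t₁` and `b t₂`. -/
def triangle (c₁ c₂ b : ℝ → ℂ) (s₁ s₂ t₁ t₂ : ℝ) : Set ℂ :=
  enclosedRegion halfLine (c₁ '' Ici s₁ ∪ c₂ '' Ici s₂ ∪ b '' Icc t₁ t₂)

/-! For an expander the support quantity `u - x u'` is the derivative of the tangent angle `arctan
u'`, and it is also twice the signed area density swept out from the origin. Turning and area are
therefore the same integral. Traversing the triangle with its interior on the left, the divergence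
theorem for the position field gives `2|A| = -∑ ∫ support` over the three sides, and the sum of the
turnings is a difference of angles, as in Gauss–Bonnet.

Area: `support` satisfies a first-order linear equation, so it has a constant sign and Gaussian
decay. Hence every ray from the origin crosses a given expander at most once, unless the expander is
a line through the origin, and always in the direction of that sign. Following the ray outward from
a generic point and counting entries into and exits from the triangle writes the indicator of the
triangle as a signed sum of indicators of cones from the origin over the sides
(`indicator_sum_of_rayStep`). The area of a cone is a Jacobian computation (`volume_coneOver`), and
integration gives `area_of_three_graphs`.

Angles: `exists_angle_eq` expresses the angle at each vertex through the turning of its infinite arm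
and the direction of the half-line seen from the frame of `b`. A secant from the vertex, which never
points straight down, fixes the branch of the argument, so the half-line contributes the same number
at both vertices and cancels.

Configuration: the height of one expander over another solves `F'' = k F + β F'` with `k > 0`, so
distinct expanders cross at most once, and transversally (`gap_graphPoint_dichotomy`). Two expanders
asymptotic to the half-line cannot cross at all, and both must cross `b` in the same direction. The
triangle is then the set where three heights are positive, and `enclosedRegion_eq` matches this set
with the topological definition. -/

/-- The support quantity `u - x u'` of a graph. -/
noncomputable def support (u : ℝ → ℝ) (x : ℝ) : ℝ := u x - x * deriv u x

theorem contDiff_one_deriv_of_two {u : ℝ → ℝ} (hu : ContDiff ℝ 2 u) : ContDiff ℝ 1 (deriv u) := by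
  have h : ContDiff ℝ (1 + 1) u := by simpa [one_add_one_eq_two] using hu
  exact (contDiff_succ_iff_deriv.1 h).2.2

theorem exists_hasDerivAt_of_continuous {f : ℝ → ℝ} (hf : Continuous f) :
    ∃ g : ℝ → ℝ, g 0 = 0 ∧ ∀ x, HasDerivAt g (f x) x :=
  ⟨fun x => ∫ t in (0 : ℝ)..x, f t, by simp, fun x =>
    intervalIntegral.integral_hasDerivAt_right (hf.intervalIntegrable _ _)
      (hf.stronglyMeasurableAtFilter _ _) hf.continuousAt⟩

/-! ### The support quantity: constant sign, decay, bounded slope -/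

namespace IsExpanderSolution

variable {u : ℝ → ℝ}

theorem hasDerivAt (hu : IsExpanderSolution u) (x : ℝ) : HasDerivAt u (deriv u x) x :=
  (hu.1.differentiable (by norm_num) x).hasDerivAt

theorem continuous_deriv (hu : IsExpanderSolution u) : Continuous (deriv u) :=
  (contDiff_one_deriv_of_two hu.1).continuous

theorem hasDerivAt_deriv (hu : IsExpanderSolution u) (x : ℝ) :
    HasDerivAt (deriv u) ((1 + deriv u x ^ 2) * support u x) x := by
  have h := ((contDiff_one_deriv_of_two hu.1).differentiable (by norm_num) x).hasDerivAt
  have h2 : deriv (deriv u) x = (1 + deriv u x ^ 2) * support u x := by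
    rw [support, hu.2 x]
    field_simp
  rwa [h2] at h

theorem continuous (hu : IsExpanderSolution u) : Continuous u := hu.1.continuous

theorem continuous_support (hu : IsExpanderSolution u) : Continuous (support u) :=
  hu.continuous.sub (continuous_id.mul hu.continuous_deriv)

theorem hasDerivAt_support (hu : IsExpanderSolution u) (x : ℝ) :
    HasDerivAt (support u) (-(x * (1 + deriv u x ^ 2)) * support u x) x := by
  have h := (hu.hasDerivAt x).sub ((hasDerivAt_id x).mul (hu.hasDerivAt_deriv x))
  exact h.congr_deriv (by simp [support]; ring)

theorem hasDerivAt_arctan_deriv (hu : IsExpanderSolution u) (x : ℝ) :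
    HasDerivAt (fun y => Real.arctan (deriv u y)) (support u x) x := by
  have h := (hu.hasDerivAt_deriv x).arctan
  convert h using 1
  have : (1 + deriv u x ^ 2) ≠ 0 := by positivity
  field_simp

/-- The support quantity never changes sign and has Gaussian decay. -/
theorem exists_support_mul_exp (hu : IsExpanderSolution u) :
    ∃ q : ℝ → ℝ, (∀ x, x ^ 2 / 2 ≤ q x) ∧ ∀ x, support u x * Real.exp (q x) = u 0 := by
  have hc := hu.continuous_deriv
  obtain ⟨q, q0, hq⟩ := exists_hasDerivAt_of_continuous
    (f := fun x => x * (1 + deriv u x ^ 2)) (by fun_prop)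
  obtain ⟨r, r0, hr⟩ := exists_hasDerivAt_of_continuous
    (f := fun x => x * deriv u x ^ 2) (by fun_prop)
  refine ⟨q, fun x => ?_, fun x => ?_⟩
  -- The exponent splits as `y²/2` plus a primitive `r` of `x u'²`, which is nonnegative on both
  -- half-lines; this gives the Gaussian factor.
  · have hqr : ∀ y, q y = y ^ 2 / 2 + r y := by
      have : ∀ y, HasDerivAt (fun y => q y - (y ^ 2 / 2 + r y)) 0 y := fun y => by
        have h := (hq y).sub ((((hasDerivAt_id y).pow 2).div_const 2).add (hr y))
        exact h.congr_deriv (by simp; ring)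
      intro y
      have h := is_const_of_deriv_eq_zero (fun z => (this z).differentiableAt)
        (fun z => (this z).deriv) y 0
      simp [q0, r0] at h
      linarith
    rw [hqr]
    have hr0 : 0 ≤ r x := by
      rcases le_total 0 x with h | h
      · have := monotoneOn_of_deriv_nonneg (convex_Ici (0 : ℝ))
          (fun z _ => (hr z).continuousAt.continuousWithinAt)
          (fun z _ => (hr z).differentiableAt.differentiableWithinAt)
          (fun z hz => by
            rw [(hr z).deriv]
            have : 0 ≤ z := interior_subset hz
            positivity)
        simpa [r0] using this (mem_Ici.2 le_rfl) (mem_Ici.2 h) h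
      · have := antitoneOn_of_deriv_nonpos (convex_Iic (0 : ℝ))
          (fun z _ => (hr z).continuousAt.continuousWithinAt)
          (fun z _ => (hr z).differentiableAt.differentiableWithinAt)
          (fun z hz => by
            rw [(hr z).deriv]
            have : z ∈ Iic (0 : ℝ) := interior_subset hz
            exact mul_nonpos_of_nonpos_of_nonneg (mem_Iic.1 this) (sq_nonneg _))
        simpa [r0] using this (mem_Iic.2 h) (mem_Iic.2 le_rfl) h
    linarith
  · have : ∀ y, HasDerivAt (fun y => support u y * Real.exp (q y)) 0 y := fun y => by
      have h := (hu.hasDerivAt_support y).mul (hq y).exp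
      exact h.congr_deriv (by ring)
    have h := is_const_of_deriv_eq_zero (fun z => (this z).differentiableAt)
        (fun z => (this z).deriv) x 0
    simpa [q0, support] using h

theorem support_trichotomy (hu : IsExpanderSolution u) :
    (∀ x, 0 < support u x) ∨ (∀ x, support u x < 0) ∨ ∀ x, support u x = 0 := by
  obtain ⟨q, -, h⟩ := hu.exists_support_mul_exp
  rcases lt_trichotomy (u 0) 0 with h0 | h0 | h0
  · exact .inr <| .inl fun x => by
      have := h x
      by_contra! hn
      have := mul_nonneg hn (Real.exp_pos (q x)).le
      linarith
  · exact .inr <| .inr fun x => by simpa [h0, (Real.exp_pos (q x)).ne'] using h x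
  · exact .inl fun x => by
      have := h x
      by_contra! hn
      have := mul_nonpos_of_nonpos_of_nonneg hn (Real.exp_pos (q x)).le
      linarith

theorem abs_support_le_exp (hu : IsExpanderSolution u) (x : ℝ) :
    |support u x| ≤ |u 0| * Real.exp (-(1 / 2) * x ^ 2) := by
  obtain ⟨q, hq, h⟩ := hu.exists_support_mul_exp
  have h1 : support u x = u 0 * Real.exp (-q x) := by
    rw [← h x, mul_assoc, ← Real.exp_add]
    simp
  rw [h1, abs_mul, Real.abs_exp]
  gcongr
  linarith [hq x]

theorem abs_support_le (hu : IsExpanderSolution u) (x : ℝ) : |support u x| ≤ |u 0| := by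
  refine (hu.abs_support_le_exp x).trans (mul_le_of_le_one_right (abs_nonneg _) ?_)
  rw [Real.exp_le_one_iff]
  nlinarith [sq_nonneg x]

theorem integrable_support (hu : IsExpanderSolution u) : Integrable (support u) := by
  refine ((integrable_exp_neg_mul_sq (b := 1 / 2) (by norm_num)).const_mul |u 0|).mono'
    hu.continuous_support.aestronglyMeasurable (.of_forall fun x => ?_)
  exact hu.abs_support_le_exp x

theorem comp_neg (hu : IsExpanderSolution u) : IsExpanderSolution fun x => u (-x) := by
  have h1 : deriv (fun x => u (-x)) = fun x => -deriv u (-x) := by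
    funext x
    exact deriv_comp_neg u x
  refine ⟨hu.1.comp contDiff_neg, fun x => ?_⟩
  have h2 : deriv (fun x => -deriv u (-x)) x = deriv (deriv u) (-x) := by
    rw [deriv.fun_neg, deriv_comp_neg (deriv u), neg_neg]
  rw [h1, h2]
  have := hu.2 (-x)
  simpa using this

theorem neg (hu : IsExpanderSolution u) : IsExpanderSolution fun x => -u x := by
  have h1 : deriv (fun x => -u x) = fun x => -deriv u x := by
    funext x
    exact deriv.fun_neg
  refine ⟨hu.1.neg, fun x => ?_⟩
  have h2 : deriv (fun x => -deriv u x) x = -deriv (deriv u) x := deriv.fun_neg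
  rw [h1, h2]
  have := hu.2 x
  rw [neg_sq, neg_div, ← this]
  ring

/-- Since `(u/x)' = -support/x²` and `|support| ≤ C`, the functions `u/x - C/x` and `u/x + C/x` are
monotone in opposite senses, which bounds `u/x`; then `u' = u/x - support/x`. -/
theorem exists_abs_deriv_le_Ici (hu : IsExpanderSolution u) :
    ∃ M, ∀ x, 1 ≤ x → |deriv u x| ≤ M := by
  set C := |u 0|
  have hx0 : ∀ z ∈ Ici (1 : ℝ), z ≠ 0 := fun z hz => (one_pos.trans_le hz).ne'
  have hd : ∀ e : ℝ, ∀ z ∈ Ici (1 : ℝ), HasDerivAt (fun z => u z / z + e / z)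
      ((-support u z - e) / z ^ 2) z := fun e z hz => by
    have h := ((hu.hasDerivAt z).div (hasDerivAt_id z) (hx0 z hz)).add
      ((hasDerivAt_const z e).div (hasDerivAt_id z) (hx0 z hz))
    refine h.congr_deriv ?_
    have := hx0 z hz
    simp [support]
    field_simp
    ring
  have hmono : ∀ x, 1 ≤ x → u 1 - C ≤ u x / x + -C / x := fun x hx => by
    have := monotoneOn_of_deriv_nonneg (convex_Ici (1 : ℝ))
      (fun z hz => (hd (-C) z hz).continuousAt.continuousWithinAt)
      (fun z hz => (hd (-C) z (interior_subset hz)).differentiableAt.differentiableWithinAt)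
      (fun z hz => by
        rw [(hd (-C) z (interior_subset hz)).deriv]
        have := (abs_le.1 (hu.abs_support_le z)).2
        apply div_nonneg _ (sq_nonneg _)
        linarith)
    have h := this (mem_Ici.2 le_rfl) (mem_Ici.2 hx) hx
    simp only [div_one] at h
    linarith
  have hanti : ∀ x, 1 ≤ x → u x / x + C / x ≤ u 1 + C := fun x hx => by
    have := antitoneOn_of_deriv_nonpos (convex_Ici (1 : ℝ))
      (fun z hz => (hd C z hz).continuousAt.continuousWithinAt)
      (fun z hz => (hd C z (interior_subset hz)).differentiableAt.differentiableWithinAt)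
      (fun z hz => by
        rw [(hd C z (interior_subset hz)).deriv]
        have := (abs_le.1 (hu.abs_support_le z)).1
        apply div_nonpos_of_nonpos_of_nonneg _ (sq_nonneg _)
        linarith)
    have h := this (mem_Ici.2 le_rfl) (mem_Ici.2 hx) hx
    simpa only [div_one] using h
  refine ⟨|u 1| + 2 * C, fun x hx => ?_⟩
  have hxp : 0 < x := by linarith
  have e1 : deriv u x = u x / x - support u x / x := by
    rw [support]
    field_simp
    ring
  have hs := hu.abs_support_le x
  have h1 := hmono x hx
  have h2 := hanti x hx
  have h3 : |support u x / x| ≤ C := by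
    rw [abs_div, abs_of_pos hxp]
    exact (div_le_self (abs_nonneg _) hx).trans hs
  have h4 : 0 ≤ C / x := by positivity
  have h5 := abs_le.1 h3
  rw [neg_div] at h1
  rw [e1]
  apply abs_le.2
  constructor <;> linarith [neg_abs_le (u 1), le_abs_self (u 1), h5.1, h5.2]

theorem exists_abs_deriv_le (hu : IsExpanderSolution u) : ∃ M, ∀ x, |deriv u x| ≤ M := by
  obtain ⟨M₁, h₁⟩ := hu.exists_abs_deriv_le_Ici
  obtain ⟨M₂, h₂⟩ := hu.comp_neg.exists_abs_deriv_le_Ici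
  obtain ⟨M₃, h₃⟩ := (isCompact_Icc (a := (-1 : ℝ)) (b := 1)).exists_bound_of_continuousOn
    hu.continuous_deriv.continuousOn
  refine ⟨max M₁ (max M₂ M₃), fun x => ?_⟩
  rcases le_total 1 x with h | h
  · exact (h₁ x h).trans (le_max_left _ _)
  rcases le_total x (-1) with h' | h'
  · have := h₂ (-x) (by linarith)
    rw [deriv_comp_neg] at this
    simp only [neg_neg, abs_neg] at this
    exact this.trans ((le_max_left _ _).trans (le_max_right _ _))
  · exact (h₃ x ⟨h', h⟩).trans ((le_max_right _ _).trans (le_max_right _ _))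

end IsExpanderSolution

/-! ### Zeros of solutions of second-order linear equations -/

section LinearODE

variable {F F' k β : ℝ → ℝ}

/-- Grönwall for the energy `F² + F'²`, whose derivative is at most `1 + |k| + 2|β|` times the
energy in absolute value. The weights `exp (-K)` and `exp K` handle the times after and before `x₀`.
-/
theorem eq_zero_of_linear_ode (hF : ∀ x, HasDerivAt F (F' x) x)
    (hF' : ∀ x, HasDerivAt F' (k x * F x + β x * F' x) x) (hk : Continuous k)
    (hβ : Continuous β) {x₀ : ℝ} (h0 : F x₀ = 0) (h0' : F' x₀ = 0) (x : ℝ) :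
    F x = 0 ∧ F' x = 0 := by
  obtain ⟨K, -, hK⟩ := exists_hasDerivAt_of_continuous
    (f := fun x => 1 + |k x| + 2 * |β x|) (by fun_prop)
  have hN : ∀ x, HasDerivAt (fun x => F x ^ 2 + F' x ^ 2)
      (2 * F x * F' x * (1 + k x) + 2 * β x * F' x ^ 2) x := fun x =>
    (((hF x).pow 2).add ((hF' x).pow 2)).congr_deriv (by simp; ring)
  have hbound : ∀ x, |2 * F x * F' x * (1 + k x) + 2 * β x * F' x ^ 2| ≤
      (1 + |k x| + 2 * |β x|) * (F x ^ 2 + F' x ^ 2) := fun x => by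
    have h1 : |2 * F x * F' x| ≤ F x ^ 2 + F' x ^ 2 := by
      rw [abs_le]
      constructor <;> nlinarith [sq_nonneg (F x + F' x), sq_nonneg (F x - F' x)]
    have h2 : |1 + k x| ≤ 1 + |k x| := (abs_add_le _ _).trans (by simp)
    have h3 : |2 * β x * F' x ^ 2| ≤ 2 * |β x| * (F x ^ 2 + F' x ^ 2) := by
      rw [abs_mul, abs_mul, abs_two, abs_of_nonneg (sq_nonneg (F' x))]
      gcongr
      linarith [sq_nonneg (F x)]
    calc _ ≤ |2 * F x * F' x| * |1 + k x| + |2 * β x * F' x ^ 2| := by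
          rw [← abs_mul]; exact abs_add_le _ _
      _ ≤ (F x ^ 2 + F' x ^ 2) * (1 + |k x|) + 2 * |β x| * (F x ^ 2 + F' x ^ 2) := by gcongr
      _ = _ := by ring
  have hanti : Antitone fun x => (F x ^ 2 + F' x ^ 2) * Real.exp (-K x) :=
    antitone_of_hasDerivAt_nonpos (fun x => (hN x).mul (hK x).neg.exp) fun x => by
      have := (abs_le.1 (hbound x)).2
      have := Real.exp_pos (-K x)
      simp only [Pi.neg_apply, Pi.zero_apply]
      nlinarith
  have hmono : Monotone fun x => (F x ^ 2 + F' x ^ 2) * Real.exp (K x) :=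
    monotone_of_hasDerivAt_nonneg (fun x => (hN x).mul (hK x).exp) fun x => by
      have := (abs_le.1 (hbound x)).1
      have := Real.exp_pos (K x)
      show 0 ≤ _
      nlinarith
  have key : F x ^ 2 + F' x ^ 2 ≤ 0 := by
    rcases le_total x₀ x with h | h
    · have := hanti h
      simp only [h0, h0', ne_eq, OfNat.ofNat_ne_zero, not_false_eq_true, zero_pow, add_zero,
        zero_mul] at this
      exact nonpos_of_mul_nonpos_left this (Real.exp_pos _)
    · have := hmono h
      simp only [h0, h0', ne_eq, OfNat.ofNat_ne_zero, not_false_eq_true, zero_pow, add_zero,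
        zero_mul] at this
      exact nonpos_of_mul_nonpos_left this (Real.exp_pos _)
  constructor <;> nlinarith [sq_nonneg (F x), sq_nonneg (F' x)]

/-- A nontrivial solution of `F'' = k F + β F'` with `k > 0` and a zero has no critical point. -/
theorem deriv_ne_zero_of_linear_ode (hF : ∀ x, HasDerivAt F (F' x) x)
    (hF' : ∀ x, HasDerivAt F' (k x * F x + β x * F' x) x) (hk : Continuous k)
    (hk0 : ∀ x, 0 < k x) (hβ : Continuous β) {x₀ : ℝ} (h0 : F x₀ = 0) (h0' : F' x₀ ≠ 0) (x : ℝ) :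
    F' x ≠ 0 := by
  have hnot : ∀ y, F y = 0 → F' y ≠ 0 := fun y hy hy' =>
    h0' (eq_zero_of_linear_ode hF hF' hk hβ hy hy' x₀).2
  obtain ⟨B, -, hB⟩ := exists_hasDerivAt_of_continuous hβ
  -- The factor `exp (-B)` removes the `β` term and leaves the derivative `(F'² + k F²) exp (-B)`,
  -- so `F F'` vanishes only once.
  have hmono : StrictMono fun x => F x * F' x * Real.exp (-B x) :=
    strictMono_of_hasDerivAt_pos (fun x => ((hF x).mul (hF' x)).mul (hB x).neg.exp) fun x => by
      have h1 := Real.exp_pos (-B x)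
      have h2 : 0 < F' x ^ 2 + k x * F x ^ 2 := by
        by_cases h : F x = 0
        · have := hnot x h
          have := hk0 x
          positivity
        · have := hk0 x
          positivity
      have := mul_pos h2 h1
      simp only [Pi.mul_apply, Pi.neg_apply]
      nlinarith
  intro hx
  have : x = x₀ := hmono.injective (by simp [hx, h0])
  exact h0' (this ▸ hx)

theorem strictMono_or_strictAnti_of_hasDerivAt_ne_zero (hF : ∀ x, HasDerivAt F (F' x) x)
    (hc : Continuous F') (h : ∀ x, F' x ≠ 0) :
    ((∀ x, 0 < F' x) ∧ StrictMono F) ∨ ((∀ x, F' x < 0) ∧ StrictAnti F) := by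
  have key : (∀ x, 0 < F' x) ∨ ∀ x, F' x < 0 := by
    by_contra! hcon
    obtain ⟨⟨a, ha⟩, b, hb⟩ := hcon
    obtain ⟨x, hx⟩ := mem_range_of_exists_le_of_exists_ge hc ⟨a, ha⟩ ⟨b, hb⟩
    exact h x hx
  exact key.imp (fun h => ⟨h, strictMono_of_hasDerivAt_pos hF h⟩)
    fun h => ⟨h, strictAnti_of_hasDerivAt_neg hF h⟩

end LinearODE

/-! ### Rotated graphs and the height of one over another -/

/-- The point over `x` of the graph of `u` rotated by `R`. -/
noncomputable def graphPoint (R : Circle) (u : ℝ → ℝ) (x : ℝ) : ℂ := R * (x + u x * Complex.I)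

/-- The tangent vector over `x` of the graph of `u` rotated by `R`. -/
noncomputable def graphTangent (R : Circle) (u : ℝ → ℝ) (x : ℝ) : ℂ :=
  R * (1 + deriv u x * Complex.I)

/-- The vertical distance (in the rotated frame) of a point above the rotated graph of `u`. -/
noncomputable def gap (R : Circle) (u : ℝ → ℝ) (p : ℂ) : ℝ :=
  (((R⁻¹ : Circle) : ℂ) * p).im - u (((R⁻¹ : Circle) : ℂ) * p).re

section Frame

variable {R S : Circle} {u v : ℝ → ℝ} {x y : ℝ}

theorem Circle.inv_coe_mul_coe_mul (R : Circle) (z : ℂ) : ((R⁻¹ : Circle) : ℂ) * (R * z) = z := by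
  rw [← mul_assoc, ← Circle.coe_mul, inv_mul_cancel, Circle.coe_one, one_mul]

theorem Circle.coe_mul_inv_coe_mul (R : Circle) (z : ℂ) : (R : ℂ) * (((R⁻¹ : Circle) : ℂ) * z) = z := by
  rw [← mul_assoc, ← Circle.coe_mul, mul_inv_cancel, Circle.coe_one, one_mul]

theorem inv_mul_graphPoint : ((R⁻¹ : Circle) : ℂ) * graphPoint R u x = x + u x * Complex.I :=
  Circle.inv_coe_mul_coe_mul _ _

@[simp] theorem gap_graphPoint : gap R u (graphPoint R u x) = 0 := by
  rw [gap, inv_mul_graphPoint]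
  simp

theorem graphPoint_of_gap_eq_zero {p : ℂ} (h : gap R u p = 0) :
    graphPoint R u (((R⁻¹ : Circle) : ℂ) * p).re = p := by
  rw [gap, sub_eq_zero] at h
  rw [graphPoint, ← h, Complex.re_add_im, Circle.coe_mul_inv_coe_mul]

theorem gap_eq_zero_iff {p : ℂ} : gap R u p = 0 ↔ ∃ x, graphPoint R u x = p :=
  ⟨fun h => ⟨_, graphPoint_of_gap_eq_zero h⟩, by rintro ⟨x, rfl⟩; simp⟩

theorem continuous_gap (hu : Continuous u) : Continuous (gap R u) := by
  unfold gap
  fun_prop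

theorem continuous_graphPoint (hu : Continuous u) : Continuous (graphPoint R u) := by
  unfold graphPoint
  fun_prop

theorem re_sq_add_im_sq (R : Circle) : (R : ℂ).re ^ 2 + (R : ℂ).im ^ 2 = 1 := by
  have := Circle.normSq_coe R
  rw [Complex.normSq_apply] at this
  linarith

theorem im_conj_mul_comm (z w : ℂ) :
    (starRingEnd ℂ z * w).im = -(starRingEnd ℂ w * z).im := by
  simp
  ring

/-- The rate of change of the height over one rotated graph along another one. -/
noncomputable def gapSlope (S : Circle) (v : ℝ → ℝ) (R : Circle) (u : ℝ → ℝ) (x : ℝ) : ℝ :=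
  (starRingEnd ℂ (graphTangent S v (((S⁻¹ : Circle) : ℂ) * graphPoint R u x).re)
    * graphTangent R u x).im

theorem gapSlope_of_graphPoint_eq (h : graphPoint R u x = graphPoint S v y) :
    gapSlope S v R u x = (starRingEnd ℂ (graphTangent S v y) * graphTangent R u x).im := by
  rw [gapSlope, h, inv_mul_graphPoint]
  simp

theorem gapSlope_eq_neg (h : graphPoint R u x = graphPoint S v y) :
    gapSlope S v R u x = -gapSlope R u S v y := by
  rw [gapSlope_of_graphPoint_eq h, gapSlope_of_graphPoint_eq h.symm, im_conj_mul_comm]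

/-- The two expander equations combine into a linear equation for the height, whose zeroth-order
coefficient `1 + u'²` is positive; this is the source of the maximum principle for crossings. -/
theorem exists_gap_graphPoint_ode (hu : IsExpanderSolution u) (hv : IsExpanderSolution v)
    (R S : Circle) :
    (∀ x, HasDerivAt (fun x => gap S v (graphPoint R u x)) (gapSlope S v R u x) x) ∧
    Continuous (gapSlope S v R u) ∧
    ∃ β : ℝ → ℝ, Continuous β ∧ ∀ x, HasDerivAt (gapSlope S v R u)
      ((1 + deriv u x ^ 2) * gap S v (graphPoint R u x) + β x * gapSlope S v R u x) x := by
  obtain ⟨A, hA⟩ : ∃ A, A = ((S⁻¹ * R : Circle) : ℂ).re := ⟨_, rfl⟩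
  obtain ⟨B, hB⟩ : ∃ B, B = ((S⁻¹ * R : Circle) : ℂ).im := ⟨_, rfl⟩
  have hAB : A ^ 2 + B ^ 2 = 1 := by rw [hA, hB, re_sq_add_im_sq]
  set X : ℝ → ℝ := fun x => A * x - B * u x with hX
  set Y : ℝ → ℝ := fun x => B * x + A * u x with hY
  have hXx : ∀ x, (((S⁻¹ : Circle) : ℂ) * graphPoint R u x).re = X x := fun x => by
    rw [graphPoint, ← mul_assoc, ← Circle.coe_mul]
    simp [hX, hA, hB]
  have hYx : ∀ x, (((S⁻¹ : Circle) : ℂ) * graphPoint R u x).im = Y x := fun x => by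
    rw [graphPoint, ← mul_assoc, ← Circle.coe_mul]
    simp [hY, hA, hB]
    ring
  have hgap : (fun x => gap S v (graphPoint R u x)) = fun x => Y x - v (X x) := by
    funext x
    rw [gap, hXx, hYx]
  have hslope : gapSlope S v R u =
      fun x => (B + A * deriv u x) - deriv v (X x) * (A - B * deriv u x) := by
    funext x
    have h1 : starRingEnd ℂ (graphTangent S v (X x)) * graphTangent R u x =
        (((S⁻¹ * R : Circle)) : ℂ) * ((1 - deriv v (X x) * Complex.I) *
          (1 + deriv u x * Complex.I)) := by
      rw [graphTangent, graphTangent, map_mul, ← Circle.coe_inv_eq_conj, Circle.coe_mul]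
      simp
      ring
    rw [gapSlope, hXx, h1, Complex.mul_im, ← hA, ← hB]
    simp
    ring
  have hX' : ∀ x, HasDerivAt X (A - B * deriv u x) x := fun x =>
    (((hasDerivAt_id x).const_mul A).sub ((hu.hasDerivAt x).const_mul B)).congr_deriv (by simp)
  have hY' : ∀ x, HasDerivAt Y (B + A * deriv u x) x := fun x =>
    (((hasDerivAt_id x).const_mul B).add ((hu.hasDerivAt x).const_mul A)).congr_deriv (by simp)
  have hXc : Continuous X := by have := hu.continuous; fun_prop
  have hYc : Continuous Y := by have := hu.continuous; fun_prop
  have huc := hu.continuous_deriv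
  have hvc := hv.continuous_deriv
  have hvs := hv.continuous_support
  refine ⟨fun x => ?_, ?_, ?_⟩
  · rw [hgap, hslope]
    exact (hY' x).sub ((hv.hasDerivAt (X x)).comp x (hX' x))
  · rw [hslope]
    fun_prop
  -- Where the slope vanishes, `Y' = v' X'`, hence `1 + u'² = (1 + v'²) X'²` and the second
  -- derivative is exactly `1 + u'²` times the height. All other terms are divisible by the slope;
  -- `β` is their quotient.
  · refine ⟨fun x => (2 * (B + A * deriv u x) -
        ((B + A * deriv u x) - deriv v (X x) * (A - B * deriv u x))) * support v (X x)
        - (1 + deriv u x ^ 2) * (B * (Y x - deriv v (X x) * X x) +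
          (A + deriv v (X x) * B) * X x), by fun_prop, fun x => ?_⟩
    have hg : gap S v (graphPoint R u x) = Y x - v (X x) := congrFun hgap x
    rw [hg, hslope]
    have h := (((hu.hasDerivAt_deriv x).const_mul A).const_add B).sub
      (((hv.hasDerivAt_deriv (X x)).comp x (hX' x)).mul
        (((hu.hasDerivAt_deriv x).const_mul B).const_sub A))
    refine h.congr_deriv ?_
    -- The support quantity is the determinant of tangent and position, so it can be computed in the
    -- frame of `S`.
    have hw : support u x = Y x * (A - B * deriv u x) - X x * (B + A * deriv u x) := by
      simp only [support, hX, hY]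
      linear_combination (-(u x) + x * deriv u x) * hAB
    have hs : support v (X x) = v (X x) - X x * deriv v (X x) := rfl
    beta_reduce
    rw [Function.comp_apply, hw, hs]
    linear_combination (1 + deriv u x ^ 2) * (Y x - v (X x)) * hAB

end Frame

/-! ### Heights along curves asymptotic to the half-line -/

theorem exists_gap_lipschitz {u : ℝ → ℝ} (hu : IsExpanderSolution u) (R : Circle) :
    ∃ M, 0 < M ∧ ∀ p q, |gap R u p - gap R u q| ≤ M * ‖p - q‖ := by
  obtain ⟨M, hM⟩ := hu.exists_abs_deriv_le
  have hM0 : 0 ≤ M := (abs_nonneg _).trans (hM 0)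
  refine ⟨1 + M, by linarith, fun p q => ?_⟩
  have hn : ‖((R⁻¹ : Circle) : ℂ) * p - ((R⁻¹ : Circle) : ℂ) * q‖ = ‖p - q‖ := by
    rw [← mul_sub, norm_mul, Circle.norm_coe, one_mul]
  have h1 : |(((R⁻¹ : Circle) : ℂ) * p).im - (((R⁻¹ : Circle) : ℂ) * q).im| ≤ ‖p - q‖ := by
    rw [← Complex.sub_im, ← hn]
    exact Complex.abs_im_le_norm _
  have h2 : |(((R⁻¹ : Circle) : ℂ) * p).re - (((R⁻¹ : Circle) : ℂ) * q).re| ≤ ‖p - q‖ := by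
    rw [← Complex.sub_re, ← hn]
    exact Complex.abs_re_le_norm _
  have h3 : |u (((R⁻¹ : Circle) : ℂ) * p).re - u (((R⁻¹ : Circle) : ℂ) * q).re| ≤
      M * ‖p - q‖ := by
    have := convex_univ.norm_image_sub_le_of_norm_deriv_le (f := u) (C := M)
      (fun z _ => (hu.hasDerivAt z).differentiableAt) (fun z _ => hM z)
      (mem_univ (((R⁻¹ : Circle) : ℂ) * q).re) (mem_univ (((R⁻¹ : Circle) : ℂ) * p).re)
    exact this.trans (by gcongr; exact h2)
  unfold gap
  rw [abs_le] at *
  constructor <;> linarith [h1.1, h1.2, h3.1, h3.2]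

/-- The curve `c` tends to infinity along the half-line of nonnegative reals. -/
structure ApproachesHalfLine (c : ℝ → ℂ) : Prop where
  continuous : Continuous c
  re : Tendsto (fun t => (c t).re) atTop atTop
  im : Tendsto (fun t => (c t).im) atTop (𝓝 0)

namespace ApproachesHalfLine

variable {c c' : ℝ → ℂ} {R : Circle} {u : ℝ → ℝ}

theorem eventually_exists (hc : ApproachesHalfLine c) (S : ℝ) {ε : ℝ} (hε : 0 < ε) :
    ∀ᶠ x : ℝ in atTop, ∃ t ≥ S, ‖c t - x‖ < ε := by
  obtain ⟨T, hT⟩ := eventually_atTop.1 ((hc.im.abs).eventually_lt_const (by simpa using hε))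
  set T' := max S T
  filter_upwards [eventually_ge_atTop (c T').re] with x hx
  have := intermediate_value_Ici (Complex.continuous_re.comp hc.continuous).continuousOn
    (a := T') hc.re
  obtain ⟨t, ht, htx⟩ := this (mem_Ici.2 hx)
  refine ⟨t, (le_max_left _ _).trans ht, ?_⟩
  have h : c t - x = (c t).im * Complex.I := by
    apply Complex.ext
    · simp at htx ⊢; linarith
    · simp
  rw [h]
  simpa using hT t ((le_max_right _ _).trans ht)

/-- A lower bound for the height along one curve approaching the half-line holds, up to an
arbitrarily small error, on the half-line. -/
theorem eventually_lt_gap (hc : ApproachesHalfLine c) (hu : IsExpanderSolution u) {a b : ℝ}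
    (hab : a < b) (h : ∀ᶠ t in atTop, b ≤ gap R u (c t)) :
    ∀ᶠ x : ℝ in atTop, a < gap R u x := by
  obtain ⟨M, hM0, hM⟩ := exists_gap_lipschitz hu R
  obtain ⟨S, hS⟩ := eventually_atTop.1 h
  filter_upwards [hc.eventually_exists S (div_pos (sub_pos.2 hab) hM0)] with x ⟨t, ht, htx⟩
  have h1 := (hM (c t) x).trans_lt ((mul_lt_mul_iff_right₀ hM0).2 htx)
  rw [mul_div_cancel₀ _ hM0.ne'] at h1
  linarith [(abs_lt.1 h1).2, hS t ht]

theorem eventually_gap_lt (hc : ApproachesHalfLine c) (hu : IsExpanderSolution u) {a b : ℝ}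
    (hab : a < b) (h : ∀ᶠ t in atTop, gap R u (c t) ≤ a) :
    ∀ᶠ x : ℝ in atTop, gap R u x < b := by
  obtain ⟨M, hM0, hM⟩ := exists_gap_lipschitz hu R
  obtain ⟨S, hS⟩ := eventually_atTop.1 h
  filter_upwards [hc.eventually_exists S (div_pos (sub_pos.2 hab) hM0)] with x ⟨t, ht, htx⟩
  have h1 := (hM (c t) x).trans_lt ((mul_lt_mul_iff_right₀ hM0).2 htx)
  rw [mul_div_cancel₀ _ hM0.ne'] at h1
  linarith [(abs_lt.1 h1).1, hS t ht]

/-- Both curves come arbitrarily close to every far point of the positive axis. The height is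
Lipschitz, so at such a point it would lie on both sides of `(a + b) / 2`. -/
theorem not_separated (hc : ApproachesHalfLine c) (hc' : ApproachesHalfLine c')
    (hu : IsExpanderSolution u) {a b : ℝ} (hab : a < b)
    (h : ∀ᶠ t in atTop, b ≤ gap R u (c t)) (h' : ∀ᶠ t in atTop, gap R u (c' t) ≤ a) : False := by
  have h1 := hc.eventually_lt_gap hu (a := (a + b) / 2) (by linarith) h
  have h2 := hc'.eventually_gap_lt hu (b := (a + b) / 2) (by linarith) h'
  obtain ⟨x, hx1, hx2⟩ := (h1.and h2).exists
  linarith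

/-- If the half-line pointed straight down in the frame of `R`, the height at a real `x` would be
`-x - u 0`, and no curve asymptotic to the half-line could stay above the graph. -/
theorem inv_ne_neg_I (hc : ApproachesHalfLine c) (hu : IsExpanderSolution u)
    (h : ∀ᶠ t in atTop, 0 ≤ gap R u (c t)) : ((R⁻¹ : Circle) : ℂ) ≠ -Complex.I := by
  intro hR
  have h1 := hc.eventually_lt_gap hu (a := -1) (by norm_num) h
  obtain ⟨x, hx1, hx2⟩ := (h1.and (eventually_ge_atTop (1 - u 0))).exists
  rw [gap, hR] at hx1
  simp at hx1
  linarith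

end ApproachesHalfLine

/-! ### Reversing a frame; crossings of two expanders -/

section

variable {R S : Circle} {u v : ℝ → ℝ}

/-- A half-turn of the frame describes the same curve with opposite orientation and exchanged sides.
It is used throughout to normalize orientations. -/
theorem gap_flip (R : Circle) (u : ℝ → ℝ) (p : ℂ) :
    gap (-R) (fun x => -u (-x)) p = -gap R u p := by
  simp [gap]
  ring

theorem graphPoint_flip (R : Circle) (u : ℝ → ℝ) (x : ℝ) :
    graphPoint (-R) (fun x => -u (-x)) x = graphPoint R u (-x) := by
  simp [graphPoint]
  ring

theorem deriv_flip (u : ℝ → ℝ) (x : ℝ) : deriv (fun x => -u (-x)) x = deriv u (-x) := by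
  rw [deriv.fun_neg, deriv_comp_neg, neg_neg]

theorem graphTangent_flip (R : Circle) (u : ℝ → ℝ) (x : ℝ) :
    graphTangent (-R) (fun x => -u (-x)) x = -graphTangent R u (-x) := by
  simp [graphTangent, deriv_flip]

theorem support_flip (u : ℝ → ℝ) (x : ℝ) : support (fun x => -u (-x)) x = -support u (-x) := by
  rw [support, support, deriv_flip]
  ring

theorem IsExpanderSolution.flip (hu : IsExpanderSolution u) :
    IsExpanderSolution fun x => -u (-x) := hu.comp_neg.neg

/-- Two expanders either coincide or cross at most once, transversally. -/
theorem gap_graphPoint_dichotomy (hu : IsExpanderSolution u) (hv : IsExpanderSolution v)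
    (R S : Circle) :
    (∀ x, gap S v (graphPoint R u x) = 0 ∧ gapSlope S v R u x = 0) ∨
    (∀ x, gap S v (graphPoint R u x) ≠ 0) ∨
    ((∀ x, 0 < gapSlope S v R u x) ∧ StrictMono fun x => gap S v (graphPoint R u x)) ∨
    ((∀ x, gapSlope S v R u x < 0) ∧ StrictAnti fun x => gap S v (graphPoint R u x)) := by
  obtain ⟨hF, hc, β, hβ, hF'⟩ := exists_gap_graphPoint_ode hu hv R S
  have hk : Continuous fun x => 1 + deriv u x ^ 2 := by
    have := hu.continuous_deriv
    fun_prop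
  by_cases h0 : ∃ x, gap S v (graphPoint R u x) = 0
  · obtain ⟨x₀, h0⟩ := h0
    by_cases h1 : gapSlope S v R u x₀ = 0
    · exact .inl fun x => eq_zero_of_linear_ode hF hF' hk hβ h0 h1 x
    · exact .inr <| .inr <| strictMono_or_strictAnti_of_hasDerivAt_ne_zero hF hc
        (deriv_ne_zero_of_linear_ode hF hF' hk (fun x => by positivity) hβ h0 h1)
  · push Not at h0
    exact .inr <| .inl h0

end

/-! ### Rays from the origin -/

section Ray

variable {u : ℝ → ℝ}

theorem hasDerivAt_ray (hu : IsExpanderSolution u) (ξ : ℝ) {l : ℝ} (hl : 0 < l) :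
    HasDerivAt (fun l => u (l * ξ) / l) (-support u (l * ξ) / l ^ 2) l := by
  have h1 : HasDerivAt (fun l => u (l * ξ)) (deriv u (l * ξ) * ξ) l :=
    (hu.hasDerivAt (l * ξ)).comp l (hasDerivAt_mul_const ξ)
  refine (h1.div (hasDerivAt_id l) hl.ne').congr_deriv ?_
  simp [support]
  ring

theorem strictAntiOn_ray (hu : IsExpanderSolution u) (hs : ∀ x, 0 < support u x) (ξ : ℝ) :
    StrictAntiOn (fun l => u (l * ξ) / l) (Ioi 0) :=
  strictAntiOn_of_deriv_neg (convex_Ioi 0)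
    (fun l hl => (hasDerivAt_ray hu ξ hl).continuousAt.continuousWithinAt) fun l hl => by
      rw [interior_Ioi] at hl
      rw [(hasDerivAt_ray hu ξ hl).deriv]
      exact div_neg_of_neg_of_pos (neg_neg_of_pos (hs _)) (pow_pos hl 2)

theorem strictMonoOn_ray (hu : IsExpanderSolution u) (hs : ∀ x, support u x < 0) (ξ : ℝ) :
    StrictMonoOn (fun l => u (l * ξ) / l) (Ioi 0) :=
  strictMonoOn_of_deriv_pos (convex_Ioi 0)
    (fun l hl => (hasDerivAt_ray hu ξ hl).continuousAt.continuousWithinAt) fun l hl => by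
      rw [interior_Ioi] at hl
      rw [(hasDerivAt_ray hu ξ hl).deriv]
      exact div_pos (neg_pos.2 (hs _)) (pow_pos hl 2)

theorem eq_mul_of_support_eq_zero (hu : IsExpanderSolution u) (hs : ∀ x, support u x = 0) (x : ℝ) :
    u x = x * deriv u 0 := by
  have h : deriv u x = deriv u 0 := is_const_of_deriv_eq_zero
    (fun z => (hu.hasDerivAt_deriv z).differentiableAt)
    (fun z => by rw [(hu.hasDerivAt_deriv z).deriv, hs, mul_zero]) x 0
  have := hs x
  rw [support, h] at this
  linarith

theorem gap_real_mul (R : Circle) (u : ℝ → ℝ) (l : ℝ) (p : ℂ) :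
    gap R u (l * p) = l * (((R⁻¹ : Circle) : ℂ) * p).im - u (l * (((R⁻¹ : Circle) : ℂ) * p).re) := by
  rw [gap, mul_left_comm, Complex.re_ofReal_mul, Complex.im_ofReal_mul]

theorem gap_real_mul' (R : Circle) (u : ℝ → ℝ) {l : ℝ} (hl : 0 < l) (p : ℂ) :
    gap R u (l * p) = l * ((((R⁻¹ : Circle) : ℂ) * p).im -
      u (l * (((R⁻¹ : Circle) : ℂ) * p).re) / l) := by
  rw [gap_real_mul]
  field_simp

/-- The behaviour of the height over an expander along a ray: it has a constant sign, or one
sign change, at `a`, in the direction given by `s`. -/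
def RayStep (f : ℝ → ℝ) (s a : ℝ) : Prop :=
  1 < a ∧ ((∀ l, 1 ≤ l → 0 < f l) ∨ (∀ l, 1 ≤ l → f l < 0) ∨
    (s = 1 ∧ f a = 0 ∧ (∀ l, 1 ≤ l → l < a → f l < 0) ∧ ∀ l, a < l → 0 < f l) ∨
    (s = -1 ∧ f a = 0 ∧ (∀ l, 1 ≤ l → l < a → 0 < f l) ∧ ∀ l, a < l → f l < 0))

/-- `s` is the sign of the support quantity of `u`. -/
def IsSupportSign (u : ℝ → ℝ) (s : ℝ) : Prop :=
  (s = 1 ∧ ∀ x, 0 < support u x) ∨ (s = -1 ∧ ∀ x, support u x < 0) ∨ (s = 0 ∧ ∀ x, support u x = 0)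

theorem exists_isSupportSign (hu : IsExpanderSolution u) : ∃ s, IsSupportSign u s := by
  rcases hu.support_trichotomy with h | h | h
  exacts [⟨1, .inl ⟨rfl, h⟩⟩, ⟨-1, .inr (.inl ⟨rfl, h⟩)⟩, ⟨0, .inr (.inr ⟨rfl, h⟩)⟩]

/-- Along the ray the height is `l` times a constant minus `u (l ξ) / l`, and the latter is strictly
monotone in a sense fixed by the sign of `support`. If `support` vanishes, the graph is a line
through the origin, which a ray starting off it never meets. -/
theorem exists_rayStep (hu : IsExpanderSolution u) (R : Circle) {s : ℝ} (hs : IsSupportSign u s)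
    {p : ℂ} (hp : gap R u p ≠ 0) : ∃ a, RayStep (fun l => gap R u (l * p)) s a := by
  set f : ℝ → ℝ := fun l => gap R u (l * p) with hf
  have hc : Continuous f := by
    have := continuous_gap (R := R) hu.continuous
    fun_prop
  by_cases h0 : ∃ a, 1 ≤ a ∧ f a = 0
  · obtain ⟨a, ha1, ha⟩ := h0
    have ha1 : 1 < a := ha1.lt_of_ne (by rintro rfl; simp [hf] at ha; exact hp ha)
    have hapos : 0 < a := by linarith
    refine ⟨a, ha1, ?_⟩
    have hfa : (((R⁻¹ : Circle) : ℂ) * p).im = u (a * (((R⁻¹ : Circle) : ℂ) * p).re) / a := by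
      have : a * _ = 0 := (gap_real_mul' R u hapos p).symm.trans ha
      simpa [hapos.ne', sub_eq_zero] using this
    have hfl : ∀ l, 0 < l → f l = l * (u (a * (((R⁻¹ : Circle) : ℂ) * p).re) / a -
        u (l * (((R⁻¹ : Circle) : ℂ) * p).re) / l) := fun l hl => by
      rw [← hfa, ← gap_real_mul' R u hl p]
    rcases hs with ⟨rfl, hs⟩ | ⟨rfl, hs⟩ | ⟨rfl, hs⟩
    · have hH := strictAntiOn_ray hu hs (((R⁻¹ : Circle) : ℂ) * p).re
      refine .inr <| .inr <| .inl ⟨rfl, ha, fun l hl hla => ?_, fun l hl => ?_⟩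
      · have hl0 : 0 < l := by linarith
        rw [hfl l hl0]
        exact mul_neg_of_pos_of_neg hl0 (sub_neg.2 (hH hl0 hapos hla))
      · have hl0 : 0 < l := by linarith
        rw [hfl l hl0]
        exact mul_pos hl0 (sub_pos.2 (hH hapos hl0 hl))
    · have hH := strictMonoOn_ray hu hs (((R⁻¹ : Circle) : ℂ) * p).re
      refine .inr <| .inr <| .inr ⟨rfl, ha, fun l hl hla => ?_, fun l hl => ?_⟩
      · have hl0 : 0 < l := by linarith
        rw [hfl l hl0]
        exact mul_pos hl0 (sub_pos.2 (hH hl0 hapos hla))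
      · have hl0 : 0 < l := by linarith
        rw [hfl l hl0]
        exact mul_neg_of_pos_of_neg hl0 (sub_neg.2 (hH hapos hl0 hl))
    · exfalso
      apply hp
      rw [gap, hfa, eq_mul_of_support_eq_zero hu hs, eq_mul_of_support_eq_zero hu hs
        (((R⁻¹ : Circle) : ℂ) * p).re]
      field_simp
      ring
  · push Not at h0
    -- Without a zero the value of `a` is irrelevant beyond `1 < a`; the sign is constant by the
    -- intermediate value theorem.
    refine ⟨2, by norm_num, ?_⟩
    by_contra! hcon
    obtain ⟨⟨x, hx1, hx⟩, ⟨y, hy1, hy⟩, -⟩ := hcon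
    obtain ⟨z, hz, hz0⟩ := isPreconnected_Ici.intermediate_value (mem_Ici.2 hx1) (mem_Ici.2 hy1)
      hc.continuousOn ⟨hx, hy⟩
    exact h0 z hz hz0

theorem RayStep.exists_zero_iff {f : ℝ → ℝ} {s a : ℝ} (h : RayStep f s a) (P : ℝ → Prop) :
    (∃ l, 1 < l ∧ f l = 0 ∧ P l) ↔ f a = 0 ∧ P a := by
  obtain ⟨ha, h⟩ := h
  refine ⟨fun ⟨l, hl, hf, hP⟩ => ?_, fun ⟨hf, hP⟩ => ⟨a, ha, hf, hP⟩⟩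
  obtain rfl : l = a := by
    rcases h with h | h | ⟨-, -, h, h'⟩ | ⟨-, -, h, h'⟩
    · exact absurd hf (h l hl.le).ne'
    · exact absurd hf (h l hl.le).ne
    · rcases lt_trichotomy l a with hla | hla | hla
      exacts [absurd hf (h l hl.le hla).ne, hla, absurd hf (h' l hla).ne']
    · rcases lt_trichotomy l a with hla | hla | hla
      exacts [absurd hf (h l hl.le hla).ne', hla, absurd hf (h' l hla).ne]
  exact ⟨hf, hP⟩

-- Telescoping along the ray: the indicator of "all three positive" goes from its value at `l = 1`
-- to `0` far out. It jumps by `sᵢ` at the zero of `fᵢ` if the other two functions are positive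
-- there, and no two of them vanish together.
open Classical in
theorem indicator_sum_of_rayStep {f₁ f₂ f₃ : ℝ → ℝ} {s₁ s₂ s₃ a₁ a₂ a₃ : ℝ}
    (h₁ : RayStep f₁ s₁ a₁) (h₂ : RayStep f₂ s₂ a₂) (h₃ : RayStep f₃ s₃ a₃)
    (h₁₂ : ∀ l, 1 < l → f₁ l = 0 → f₂ l ≠ 0) (h₁₃ : ∀ l, 1 < l → f₁ l = 0 → f₃ l ≠ 0)
    (h₂₃ : ∀ l, 1 < l → f₂ l = 0 → f₃ l ≠ 0)
    (hb : ∃ B, ∀ l, B ≤ l → ¬ (0 < f₁ l ∧ 0 < f₂ l ∧ 0 < f₃ l)) :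
    (if 0 < f₁ 1 ∧ 0 < f₂ 1 ∧ 0 < f₃ 1 then (1 : ℝ) else 0) +
      s₁ * (if ∃ l, 1 < l ∧ f₁ l = 0 ∧ 0 < f₂ l ∧ 0 < f₃ l then 1 else 0) +
      s₂ * (if ∃ l, 1 < l ∧ f₂ l = 0 ∧ 0 < f₁ l ∧ 0 < f₃ l then 1 else 0) +
      s₃ * (if ∃ l, 1 < l ∧ f₃ l = 0 ∧ 0 < f₁ l ∧ 0 < f₂ l then 1 else 0) = 0 := by
  rw [h₁.exists_zero_iff, h₂.exists_zero_iff, h₃.exists_zero_iff]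
  obtain ⟨B, hB⟩ := hb
  obtain ⟨L, hLB, hL1, hL2, hL3⟩ : ∃ L, B ≤ L ∧ a₁ < L ∧ a₂ < L ∧ a₃ < L := by
    refine ⟨max B (max a₁ (max a₂ a₃)) + 1, ?_, ?_, ?_, ?_⟩ <;> grind
  have hBL := hB L hLB
  clear hB hLB B
  obtain ⟨ha₁, h₁⟩ := h₁
  obtain ⟨ha₂, h₂⟩ := h₂
  obtain ⟨ha₃, h₃⟩ := h₃
  have e12 := h₁₂ a₁ ha₁
  have e12' := h₁₂ a₂ ha₂
  have e13 := h₁₃ a₁ ha₁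
  have e13' := h₁₃ a₃ ha₃
  have e23 := h₂₃ a₂ ha₂
  have e23' := h₂₃ a₃ ha₃
  clear h₁₂ h₁₃ h₂₃
  rcases h₁ with h₁ | h₁ | ⟨rfl, z₁, h₁, k₁⟩ | ⟨rfl, z₁, h₁, k₁⟩ <;>
  rcases h₂ with h₂ | h₂ | ⟨rfl, z₂, h₂, k₂⟩ | ⟨rfl, z₂, h₂, k₂⟩ <;>
  rcases h₃ with h₃ | h₃ | ⟨rfl, z₃, h₃, k₃⟩ | ⟨rfl, z₃, h₃, k₃⟩ <;>
  grind
end Ray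

/-! ### Areas of cones from the origin -/

section Area

variable {u : ℝ → ℝ}

/-- The open cone with vertex at the origin over the part of a rotated graph over `X`. -/
def coneOver (R : Circle) (u : ℝ → ℝ) (X : Set ℝ) : Set ℂ :=
  {p | ∃ l : ℝ, 1 < l ∧ ∃ x ∈ X, graphPoint R u x = l * p}

theorem volume_span_singleton (z : ℂ) : volume ((Submodule.span ℝ {z} : Submodule ℝ ℂ) : Set ℂ) = 0 := by
  refine Measure.addHaar_submodule _ _ fun h => ?_
  have h1 : Module.finrank ℝ (Submodule.span ℝ {z}) ≤ 1 := by
    simpa using finrank_span_le_card (R := ℝ) {z}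
  rw [h, finrank_top, Complex.finrank_real_complex] at h1
  norm_num at h1

theorem volume_im_eq_zero : volume {z : ℂ | z.im = 0} = 0 := by
  refine measure_mono_null (fun z hz => ?_) (volume_span_singleton 1)
  refine Submodule.mem_span_singleton.2 ⟨z.re, ?_⟩
  apply Complex.ext <;> simp
  exact hz.symm

theorem volume_gap_eq_zero (hu : IsExpanderSolution u) (R : Circle) :
    volume {p | gap R u p = 0} = 0 := by
  have hd : Differentiable ℝ fun z : ℂ => graphPoint R u z.re := by
    have h1 : Differentiable ℝ u := fun x => (hu.hasDerivAt x).differentiableAt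
    have h2 : Differentiable ℝ fun z : ℂ => z.re := Complex.reCLM.differentiable
    have h3 : Differentiable ℝ fun z : ℂ => ((z.re : ℝ) : ℂ) :=
      Complex.ofRealCLM.differentiable.comp h2
    have h4 : Differentiable ℝ fun z : ℂ => ((u z.re : ℝ) : ℂ) :=
      Complex.ofRealCLM.differentiable.comp (h1.comp h2)
    exact (h3.add (h4.mul_const _)).const_mul _
  refine measure_mono_null (fun p hp => ?_)
    (addHaar_image_eq_zero_of_differentiableOn_of_addHaar_eq_zero volume hd.differentiableOn
      volume_im_eq_zero)
  exact ⟨((((R⁻¹ : Circle) : ℂ) * p).re : ℝ), by simp, by simpa using graphPoint_of_gap_eq_zero hp⟩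

theorem coneOver_eq_preimage (R : Circle) (u : ℝ → ℝ) (X : Set ℝ) :
    coneOver R u X = (fun z => Complex.measurableEquivRealProd ((rotation R).symm z)) ⁻¹'
      ((fun q : ℝ × ℝ => (q.2 * q.1, q.2 * u q.1)) '' (X ×ˢ Ioo 0 1)) := by
  ext p
  simp only [coneOver, mem_ofPred_eq, mem_preimage, mem_image, Prod.exists, mem_prod, mem_Ioo,
    Complex.measurableEquivRealProd_apply, Prod.mk.injEq, rotation_symm, rotation_apply]
  constructor
  · rintro ⟨l, hl, x, hx, h⟩
    have hl0 : 0 < l := by linarith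
    have h2 : ((R⁻¹ : Circle) : ℂ) * graphPoint R u x = ((R⁻¹ : Circle) : ℂ) * (l * p) := by rw [h]
    rw [inv_mul_graphPoint, mul_left_comm] at h2
    have hre := congrArg Complex.re h2
    have him := congrArg Complex.im h2
    rw [Complex.re_ofReal_mul] at hre
    rw [Complex.im_ofReal_mul] at him
    simp only [Complex.add_re, Complex.ofReal_re, Complex.mul_re, Complex.I_re, mul_zero,
      Complex.ofReal_im, Complex.I_im, mul_one, sub_self, add_zero, Complex.add_im,
      Complex.mul_im, zero_add] at hre him
    refine ⟨x, l⁻¹, ⟨hx, inv_pos.2 hl0, inv_lt_one_of_one_lt₀ hl⟩, ?_, ?_⟩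
    · rw [hre, Complex.mul_re]; field_simp
    · rw [him, Complex.mul_im]; field_simp
  · rintro ⟨x, m, ⟨hx, hm0, hm1⟩, hre, him⟩
    refine ⟨m⁻¹, (one_lt_inv₀ hm0).2 hm1, x, hx, ?_⟩
    have : ((R⁻¹ : Circle) : ℂ) * p = m * (x + u x * Complex.I) := by
      apply Complex.ext
      · rw [← hre]; simp
      · rw [← him]; simp
    rw [graphPoint, ← Circle.coe_mul_inv_coe_mul R p, this]
    have : (m : ℂ) ≠ 0 := by exact_mod_cast hm0.ne'
    push_cast
    field_simp

theorem measurePreserving_rotation_symm (R : Circle) :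
    MeasurePreserving (fun z => Complex.measurableEquivRealProd ((rotation R).symm z)) volume
      volume :=
  Complex.volume_preserving_equiv_real_prod.comp (rotation R).symm.measurePreserving

theorem injOn_cone (hu : IsExpanderSolution u)
    (hs : (∀ x, 0 < support u x) ∨ ∀ x, support u x < 0) :
    InjOn (fun q : ℝ × ℝ => (q.2 * q.1, q.2 * u q.1)) (univ ×ˢ Ioo 0 1) := by
  rintro ⟨x, m⟩ ⟨-, hm, -⟩ ⟨y, n⟩ ⟨-, hn, -⟩ h
  simp only [Prod.mk.injEq] at h hm hn
  obtain ⟨h1, h2⟩ := h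
  have hinj : InjOn (fun l => u (l * (m * x)) / l) (Ioi 0) := by
    rcases hs with hs | hs
    · exact (strictAntiOn_ray hu hs _).injOn
    · exact (strictMonoOn_ray hu hs _).injOn
  have := hinj (mem_Ioi.2 (inv_pos.2 hm)) (mem_Ioi.2 (inv_pos.2 hn)) (by
    simp only
    rw [inv_mul_cancel_left₀ hm.ne', h1, inv_mul_cancel_left₀ hn.ne', div_inv_eq_mul,
      div_inv_eq_mul, mul_comm, h2, mul_comm])
  have hmn : m = n := inv_injective this
  subst hmn
  simp only [Prod.mk.injEq, and_true]
  exact mul_left_cancel₀ hm.ne' h1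

/-- In the coordinates `(x, m) ↦ m (x, u x)` the Jacobian is `m * support u x`, and `m` integrates
to `1/2` over `(0, 1)`. These coordinates are injective because rays cross the graph at most once.
When `support` vanishes, the cone lies in a line. -/
theorem volume_coneOver (hu : IsExpanderSolution u) (R : Circle) {X : Set ℝ}
    (hX : MeasurableSet X) :
    volume (coneOver R u X) = ∫⁻ x in X, ENNReal.ofReal (|support u x| / 2) := by
  have main : ((∀ x, 0 < support u x) ∨ ∀ x, support u x < 0) →
      volume (coneOver R u X) = ∫⁻ x in X, ENNReal.ofReal (|support u x| / 2) := by
    intro hs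
    set f : ℝ × ℝ → ℝ × ℝ := fun q => (q.2 * q.1, q.2 * u q.1) with hf
    have hm : MeasurableSet (X ×ˢ Ioo (0 : ℝ) 1) := hX.prod measurableSet_Ioo
    have hder : ∀ q : ℝ × ℝ, HasFDerivAt f
        (LinearMap.toContinuousLinearMap
          (Matrix.toLin (Module.Basis.finTwoProd ℝ) (Module.Basis.finTwoProd ℝ)
          !![q.2, q.1; q.2 * deriv u q.1, u q.1])) q := fun q => by
      rw [Matrix.toLin_finTwoProd_toContinuousLinearMap]
      have h1 : HasFDerivAt (fun q : ℝ × ℝ => q.1) (ContinuousLinearMap.fst ℝ ℝ ℝ) q :=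
        hasFDerivAt_fst
      have h2 : HasFDerivAt (fun q : ℝ × ℝ => q.2) (ContinuousLinearMap.snd ℝ ℝ ℝ) q :=
        hasFDerivAt_snd
      have h3 : HasFDerivAt (fun q : ℝ × ℝ => u q.1)
          (deriv u q.1 • ContinuousLinearMap.fst ℝ ℝ ℝ) q :=
        (hu.hasDerivAt q.1).comp_hasFDerivAt q h1
      refine ((h2.mul h1).prodMk (h2.mul h3)).congr_fderiv ?_
      ext <;> simp
    have hdet : ∀ q : ℝ × ℝ, (LinearMap.toContinuousLinearMap
          (Matrix.toLin (Module.Basis.finTwoProd ℝ) (Module.Basis.finTwoProd ℝ)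
          !![q.2, q.1; q.2 * deriv u q.1, u q.1])).det = q.2 * support u q.1 := fun q => by
      simp only [LinearMap.det_toContinuousLinearMap, LinearMap.det_toLin, Matrix.det_fin_two_of]
      rw [support]
      ring
    have hinj : InjOn f (X ×ˢ Ioo (0 : ℝ) 1) :=
      (injOn_cone hu hs).mono (prod_mono (subset_univ _) Subset.rfl)
    have hmeas : MeasurableSet (f '' (X ×ˢ Ioo (0 : ℝ) 1)) :=
      measurable_image_of_fderivWithin hm (fun q _ => (hder q).hasFDerivWithinAt) hinj
    have hsupp := hu.continuous_support
    have h01 : ∫⁻ y in Ioo (0 : ℝ) 1, ENNReal.ofReal y = ENNReal.ofReal (1 / 2) := by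
      rw [← ofReal_integral_eq_lintegral_ofReal, ← integral_Ioc_eq_integral_Ioo,
        ← intervalIntegral.integral_of_le zero_le_one, integral_id]
      · norm_num
      · exact (continuous_id.integrableOn_Icc (a := (0 : ℝ)) (b := 1)).mono_set Ioo_subset_Icc_self
      · exact (ae_restrict_mem measurableSet_Ioo).mono fun y hy => hy.1.le
    rw [coneOver_eq_preimage, (measurePreserving_rotation_symm R).measure_preimage
      hmeas.nullMeasurableSet,
      ← lintegral_abs_det_fderiv_eq_addHaar_image volume hm
        (fun q _ => (hder q).hasFDerivWithinAt) hinj]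
    simp_rw [hdet]
    rw [Measure.volume_eq_prod, setLIntegral_prod _ (by fun_prop)]
    refine lintegral_congr fun x => ?_
    calc ∫⁻ y in Ioo (0 : ℝ) 1, ENNReal.ofReal |y * support u x|
        = ∫⁻ y in Ioo (0 : ℝ) 1, ENNReal.ofReal y * ENNReal.ofReal |support u x| :=
          setLIntegral_congr_fun measurableSet_Ioo fun y hy => by
            rw [abs_mul, abs_of_pos hy.1, ENNReal.ofReal_mul hy.1.le]
      _ = ENNReal.ofReal (1 / 2) * ENNReal.ofReal |support u x| := by
          rw [lintegral_mul_const _ ENNReal.measurable_ofReal, h01]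
      _ = _ := by
          rw [← ENNReal.ofReal_mul (by norm_num)]
          congr 1
          ring
  rcases hu.support_trichotomy with h | h | h
  · exact main (.inl h)
  · exact main (.inr h)
  · simp only [h, abs_zero, zero_div, ENNReal.ofReal_zero, lintegral_const, zero_mul]
    refine measure_mono_null (fun p hp => ?_) (volume_span_singleton (graphPoint R u 1))
    obtain ⟨l, hl, x, -, hx⟩ := hp
    refine Submodule.mem_span_singleton.2 ⟨l⁻¹ * x, ?_⟩
    have hl0 : (l : ℂ) ≠ 0 := by exact_mod_cast (one_pos.trans hl).ne'
    have : p = (l : ℂ)⁻¹ * graphPoint R u x := by rw [hx]; field_simp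
    rw [this, graphPoint, graphPoint, eq_mul_of_support_eq_zero hu h x,
      eq_mul_of_support_eq_zero hu h 1]
    simp
    ring

/-- Multiplying by the sign `s` removes the absolute value, so the signed area becomes half of the
total turning. -/
theorem coneOver_area (hu : IsExpanderSolution u) (R : Circle) {s : ℝ} (hs : IsSupportSign u s)
    {X : Set ℝ} (hX : MeasurableSet X) :
    volume (coneOver R u X) < ⊤ ∧
      2 * (s * volume.real (coneOver R u X)) = ∫ x in X, support u x := by
  have hi : IntegrableOn (fun x => |support u x| / 2) X :=
    (hu.integrable_support.abs.div_const 2).integrableOn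
  have h1 : volume (coneOver R u X) = ENNReal.ofReal (∫ x in X, |support u x| / 2) := by
    rw [volume_coneOver hu R hX, ofReal_integral_eq_lintegral_ofReal hi
      (.of_forall fun x => by positivity)]
  refine ⟨h1 ▸ ENNReal.ofReal_lt_top, ?_⟩
  rw [Measure.real, h1, ENNReal.toReal_ofReal (integral_nonneg fun x => by positivity),
    ← integral_const_mul, ← integral_const_mul]
  refine integral_congr_ae (.of_forall fun x => ?_)
  simp only
  rcases hs with ⟨rfl, hs⟩ | ⟨rfl, hs⟩ | ⟨rfl, hs⟩
  · rw [abs_of_pos (hs x)]; ring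
  · rw [abs_of_neg (hs x)]; ring
  · rw [hs x]; ring

end Area

/-! ### The region above three expanders as a signed sum of cones -/

section Triangle

theorem nullMeasurableSet_coneOver {u : ℝ → ℝ} (hu : IsExpanderSolution u) (R : Circle) {X : Set ℝ}
    (hX : MeasurableSet X) : NullMeasurableSet (coneOver R u X) := by
  have main : ((∀ x, 0 < support u x) ∨ ∀ x, support u x < 0) →
      NullMeasurableSet (coneOver R u X) := by
    intro hs
    have hc := hu.continuous
    have : MeasurableSet ((fun q : ℝ × ℝ => (q.2 * q.1, q.2 * u q.1)) '' (X ×ˢ Ioo 0 1)) :=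
      (hX.prod measurableSet_Ioo).image_of_continuousOn_injOn (by fun_prop)
        ((injOn_cone hu hs).mono (prod_mono (subset_univ _) Subset.rfl))
    rw [coneOver_eq_preimage]
    exact ((measurePreserving_rotation_symm R).measurable this).nullMeasurableSet
  rcases hu.support_trichotomy with h | h | h
  · exact main (.inl h)
  · exact main (.inr h)
  · refine .of_null ?_
    rw [volume_coneOver hu R hX]
    simp [h]

variable {R₁ R₂ R₃ : Circle} {u₁ u₂ u₃ : ℝ → ℝ}

theorem mem_coneOver_iff {R : Circle} {u : ℝ → ℝ} {X : Set ℝ} {P : ℂ → Prop}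
    (h : ∀ x, P (graphPoint R u x) ↔ x ∈ X) {p : ℂ} :
    p ∈ coneOver R u X ↔ ∃ l : ℝ, 1 < l ∧ gap R u (l * p) = 0 ∧ P (l * p) := by
  constructor
  · rintro ⟨l, hl, x, hx, hp⟩
    exact ⟨l, hl, by rw [← hp, gap_graphPoint], hp ▸ (h x).2 hx⟩
  · rintro ⟨l, hl, h0, hP⟩
    obtain ⟨x, hx⟩ := gap_eq_zero_iff.1 h0
    exact ⟨l, hl, x, (h x).1 (hx ▸ hP), hx⟩

theorem ae_real_mul_ne (q : ℂ) : ∀ᵐ p : ℂ, ∀ l : ℝ, 1 < l → (l : ℂ) * p ≠ q := by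
  rw [ae_iff]
  refine measure_mono_null (fun p hp => ?_) (volume_span_singleton q)
  simp only [mem_ofPred_eq, not_forall, not_not] at hp
  obtain ⟨l, hl, rfl⟩ := hp
  refine Submodule.mem_span_singleton.2 ⟨l⁻¹, ?_⟩
  have hl0 : (l : ℂ) ≠ 0 := by exact_mod_cast (one_pos.trans hl).ne'
  simp
  field_simp

/-- Almost everywhere the indicator of the region is minus the signed sum of the indicators of the
cones over its three sides; integrating this identity gives both finiteness and the value. -/
theorem area_of_three_graphs (h₁ : IsExpanderSolution u₁) (h₂ : IsExpanderSolution u₂)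
    (h₃ : IsExpanderSolution u₃)
    (h₁₂ : ∀ p, gap R₁ u₁ p = 0 → gap R₂ u₂ p ≠ 0)
    {q₁ q₂ : ℂ} (h₁₃ : ∀ p, gap R₁ u₁ p = 0 → gap R₃ u₃ p = 0 → p = q₁)
    (h₂₃ : ∀ p, gap R₂ u₂ p = 0 → gap R₃ u₃ p = 0 → p = q₂)
    {r : ℝ} (hr : ∀ p, 0 < gap R₁ u₁ p → 0 < gap R₂ u₂ p → 0 < gap R₃ u₃ p → |p.im| ≤ r)
    {X₁ X₂ X₃ : Set ℝ} (m₁ : MeasurableSet X₁) (m₂ : MeasurableSet X₂) (m₃ : MeasurableSet X₃)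
    (hX₁ : ∀ x, (0 < gap R₂ u₂ (graphPoint R₁ u₁ x) ∧ 0 < gap R₃ u₃ (graphPoint R₁ u₁ x)) ↔ x ∈ X₁)
    (hX₂ : ∀ x, (0 < gap R₁ u₁ (graphPoint R₂ u₂ x) ∧ 0 < gap R₃ u₃ (graphPoint R₂ u₂ x)) ↔ x ∈ X₂)
    (hX₃ : ∀ x, (0 < gap R₁ u₁ (graphPoint R₃ u₃ x) ∧ 0 < gap R₂ u₂ (graphPoint R₃ u₃ x)) ↔
      x ∈ X₃) :
    volume {p | 0 < gap R₁ u₁ p ∧ 0 < gap R₂ u₂ p ∧ 0 < gap R₃ u₃ p} < ⊤ ∧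
    2 * volume.real {p | 0 < gap R₁ u₁ p ∧ 0 < gap R₂ u₂ p ∧ 0 < gap R₃ u₃ p} =
      -(∫ x in X₁, support u₁ x) - (∫ x in X₂, support u₂ x) - ∫ x in X₃, support u₃ x := by
  classical
  obtain ⟨s₁, hs₁⟩ := exists_isSupportSign h₁
  obtain ⟨s₂, hs₂⟩ := exists_isSupportSign h₂
  obtain ⟨s₃, hs₃⟩ := exists_isSupportSign h₃
  set U := {p | 0 < gap R₁ u₁ p ∧ 0 < gap R₂ u₂ p ∧ 0 < gap R₃ u₃ p} with hU
  have hUm : MeasurableSet U := by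
    have hp : ∀ {R : Circle} {u : ℝ → ℝ}, IsExpanderSolution u →
        MeasurableSet {p | 0 < gap R u p} := fun hu =>
      (isOpen_lt continuous_const (continuous_gap hu.continuous)).measurableSet
    exact (hp h₁).inter ((hp h₂).inter (hp h₃))
  set C₁ := coneOver R₁ u₁ X₁
  set C₂ := coneOver R₂ u₂ X₂
  set C₃ := coneOver R₃ u₃ X₃
  obtain ⟨f₁, e₁⟩ := coneOver_area h₁ R₁ hs₁ m₁
  obtain ⟨f₂, e₂⟩ := coneOver_area h₂ R₂ hs₂ m₂
  obtain ⟨f₃, e₃⟩ := coneOver_area h₃ R₃ hs₃ m₃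
  have n₁ := nullMeasurableSet_coneOver h₁ R₁ m₁
  have n₂ := nullMeasurableSet_coneOver h₂ R₂ m₂
  have n₃ := nullMeasurableSet_coneOver h₃ R₃ m₃
  have key : ∀ᵐ p : ℂ, U.indicator (fun _ => (1 : ℝ)) p =
      -(s₁ * C₁.indicator (fun _ => 1) p + s₂ * C₂.indicator (fun _ => 1) p +
        s₃ * C₃.indicator (fun _ => 1) p) := by
    have g₁ : ∀ᵐ p : ℂ, gap R₁ u₁ p ≠ 0 := by rw [ae_iff]; simpa using volume_gap_eq_zero h₁ R₁
    have g₂ : ∀ᵐ p : ℂ, gap R₂ u₂ p ≠ 0 := by rw [ae_iff]; simpa using volume_gap_eq_zero h₂ R₂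
    have g₃ : ∀ᵐ p : ℂ, gap R₃ u₃ p ≠ 0 := by rw [ae_iff]; simpa using volume_gap_eq_zero h₃ R₃
    have g₄ : ∀ᵐ p : ℂ, p.im ≠ 0 := by rw [ae_iff]; simpa using volume_im_eq_zero
    -- The null sets discarded are the graphs, the real axis, whose rays need not leave the strip
    -- `|im| ≤ r`, and the points whose outward ray hits a vertex, where two heights vanish at once.
    filter_upwards [g₁, g₂, g₃, g₄, ae_real_mul_ne q₁, ae_real_mul_ne q₂] with p g₁ g₂ g₃ g₄ r₁ r₂
    obtain ⟨a₁, t₁⟩ := exists_rayStep h₁ R₁ hs₁ g₁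
    obtain ⟨a₂, t₂⟩ := exists_rayStep h₂ R₂ hs₂ g₂
    obtain ⟨a₃, t₃⟩ := exists_rayStep h₃ R₃ hs₃ g₃
    have := indicator_sum_of_rayStep t₁ t₂ t₃ (fun l _ h => h₁₂ _ h)
      (fun l hl h h' => r₁ l hl (h₁₃ _ h h')) (fun l hl h h' => r₂ l hl (h₂₃ _ h h'))
      ⟨(r + 1) / |p.im|, fun l hl ⟨b₁, b₂, b₃⟩ => by
        have h := hr _ b₁ b₂ b₃
        have hp : 0 < |p.im| := abs_pos.2 g₄
        rw [Complex.im_ofReal_mul, abs_mul] at h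
        rw [div_le_iff₀ hp] at hl
        nlinarith [le_abs_self l]⟩
    have i₁ := mem_coneOver_iff (p := p) (P := fun p => 0 < gap R₂ u₂ p ∧ 0 < gap R₃ u₃ p) hX₁
    have i₂ := mem_coneOver_iff (p := p) (P := fun p => 0 < gap R₁ u₁ p ∧ 0 < gap R₃ u₃ p) hX₂
    have i₃ := mem_coneOver_iff (p := p) (P := fun p => 0 < gap R₁ u₁ p ∧ 0 < gap R₂ u₂ p) hX₃
    simp only [← i₁, ← i₂, ← i₃, Complex.ofReal_one, one_mul] at this
    simp only [indicator_apply, hU, mem_ofPred_eq]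
    linarith
  have hint : ∀ {C : Set ℂ}, NullMeasurableSet C → volume C < ⊤ →
      Integrable (C.indicator fun _ => (1 : ℝ)) ∧
      ∫ p, C.indicator (fun _ => (1 : ℝ)) p = volume.real C := fun hC hf => by
    refine ⟨IntegrableOn.integrable_indicator₀ (integrableOn_const hf.ne) hC, ?_⟩
    rw [integral_indicator₀ hC]
    simp
  obtain ⟨j₁, k₁⟩ := hint n₁ f₁
  obtain ⟨j₂, k₂⟩ := hint n₂ f₂
  obtain ⟨j₃, k₃⟩ := hint n₃ f₃
  have hUi : Integrable (U.indicator fun _ => (1 : ℝ)) :=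
    ((((j₁.const_mul s₁).add (j₂.const_mul s₂)).add (j₃.const_mul s₃)).neg).congr
      (key.mono fun p hp => hp.symm)
  have hUf : volume U < ⊤ := by
    have := (integrable_indicator_iff hUm).1 hUi
    rw [integrableOn_const_iff] at this
    simpa using this
  refine ⟨hUf, ?_⟩
  rw [← (hint hUm.nullMeasurableSet hUf).2, integral_congr_ae key, integral_neg, integral_add,
    integral_add, integral_const_mul, integral_const_mul, integral_const_mul, k₁, k₂, k₃]
  · linarith
  · exact j₁.const_mul s₁
  · exact j₂.const_mul s₂
  · exact (j₁.const_mul s₁).add (j₂.const_mul s₂)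
  · exact j₃.const_mul s₃

end Triangle

/-! ### The enclosed region as an intersection of three sides -/

section Region

theorem halfLine_nonempty : halfLine.Nonempty := ⟨0, by simp [halfLine]⟩

theorem abs_im_le_infDist_halfLine (z : ℂ) : |z.im| ≤ Metric.infDist z halfLine := by
  refine (Metric.le_infDist halfLine_nonempty).2 fun {y} hy => ?_
  have := Complex.abs_im_le_norm (z - y)
  rw [Complex.sub_im, hy.2, sub_zero] at this
  rwa [Complex.dist_eq]

theorem neg_re_le_infDist_halfLine (z : ℂ) : -z.re ≤ Metric.infDist z halfLine := by
  refine (Metric.le_infDist halfLine_nonempty).2 fun {y} hy => ?_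
  have := (abs_le.1 (Complex.abs_re_le_norm (z - y))).1
  rw [Complex.sub_re] at this
  rw [Complex.dist_eq]
  linarith [hy.1]

theorem infDist_halfLine_le (z : ℂ) : Metric.infDist z halfLine ≤ max (-z.re) 0 + |z.im| := by
  have h : ((max z.re 0 : ℝ) : ℂ) ∈ halfLine := by simp [halfLine]
  refine (Metric.infDist_le_dist_of_mem h).trans ?_
  rw [Complex.dist_eq]
  refine (Complex.norm_le_abs_re_add_abs_im _).trans (le_of_eq ?_)
  simp only [Complex.sub_re, Complex.ofReal_re, Complex.sub_im, Complex.ofReal_im, sub_zero]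
  congr 1
  rcases le_total z.re 0 with h | h
  · rw [max_eq_right h, max_eq_left (by linarith), sub_zero, abs_of_nonpos h]
  · rw [max_eq_left h, max_eq_right (by linarith), sub_self, abs_zero]

/-- The points outside a half-strip around the half-line. -/
def outsideStrip (r : ℝ) : Set ℂ := {z | z.re < -r ∨ r < z.im ∨ z.im < -r}

theorem isPreconnected_outsideStrip (r : ℝ) : IsPreconnected (outsideStrip r) := by
  have h1 : IsPreconnected {z : ℂ | z.re < -r} := (convex_halfSpace_re_lt _).isPreconnected
  have h2 : IsPreconnected {z : ℂ | r < z.im} := (convex_halfSpace_im_gt _).isPreconnected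
  have h3 : IsPreconnected {z : ℂ | z.im < -r} := (convex_halfSpace_im_lt _).isPreconnected
  have h12 := h1.union' ⟨⟨-r - 1, r + 1⟩, by simp, by simp⟩ h2
  have h123 := h12.union' ⟨⟨-r - 1, -r - 1⟩, by simp, by simp⟩ h3
  convert h123 using 1
  ext z
  simp [outsideStrip, or_assoc]

theorem mem_outsideStrip_of_lt_infDist {r : ℝ} (hr : 0 ≤ r) {z : ℂ}
    (h : 2 * r < Metric.infDist z halfLine) : z ∈ outsideStrip r := by
  by_contra hcon
  simp only [outsideStrip, mem_ofPred_eq, not_or, not_lt] at hcon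
  obtain ⟨h1, h2, h3⟩ := hcon
  have h4 : max (-z.re) 0 ≤ r := max_le (by linarith) hr
  have h5 : |z.im| ≤ r := abs_le.2 ⟨h3, h2⟩
  linarith [infDist_halfLine_le z]

/-- The open set below a rotated graph is far from the half-line in the direction `-R i`. -/
theorem exists_infDist_gt_of_gap_neg {R : Circle} {u : ℝ → ℝ}
    (hR : ((R⁻¹ : Circle) : ℂ) ≠ -Complex.I) {p : ℂ} (hp : gap R u p < 0) {Γ : Set ℂ}
    (hΓ : ∀ q ∈ Γ, 0 ≤ gap R u q) (r : ℝ) :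
    ∃ q ∈ connectedComponentIn Γᶜ p, gap R u q < 0 ∧ r < Metric.infDist q halfLine := by
  set ray : ℝ → ℂ := fun t => p - R * (t * Complex.I) with hray
  have hgap : ∀ t, gap R u (ray t) = gap R u p - t := fun t => by
    have h : ((R⁻¹ : Circle) : ℂ) * ray t = ((R⁻¹ : Circle) : ℂ) * p - t * Complex.I := by
      rw [hray, mul_sub, Circle.inv_coe_mul_coe_mul]
    rw [gap, gap, h]
    simp
    ring
  have hneg : ∀ t, 0 ≤ t → gap R u (ray t) < 0 := fun t ht => by rw [hgap]; linarith
  have hcomp : ray '' Ici 0 ⊆ connectedComponentIn Γᶜ p := by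
    refine (isPreconnected_Ici.image ray (by fun_prop)).subset_connectedComponentIn
      ⟨0, mem_Ici.2 le_rfl, by simp [hray]⟩ ?_
    rintro _ ⟨t, ht, rfl⟩ hmem
    exact (hneg t ht).not_ge (hΓ _ hmem)
  suffices h : ∃ t, 0 ≤ t ∧ r < Metric.infDist (ray t) halfLine by
    obtain ⟨t, ht, h⟩ := h
    exact ⟨_, hcomp ⟨t, ht, rfl⟩, hneg t ht, h⟩
  have hre : ∀ t, (ray t).re = p.re + t * (R : ℂ).im := fun t => by simp [hray]; ring
  have him : ∀ t, (ray t).im = p.im - t * (R : ℂ).re := fun t => by simp [hray]; ring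
  -- The downward ray has unbounded imaginary part unless it is horizontal. In that case the
  -- excluded value of `R` leaves only `R = -i`, for which the ray runs towards real part `-∞`.
  by_cases h0 : (R : ℂ).re = 0
  · have h1 : (R : ℂ).im = -1 := by
      have := re_sq_add_im_sq R
      rw [h0, zero_pow two_ne_zero, zero_add] at this
      refine (mul_self_eq_one_iff.1 (by rwa [← sq])).resolve_left fun h => hR ?_
      rw [Circle.coe_inv_eq_conj]
      apply Complex.ext <;> simp [h0, h]
    refine ⟨max 0 (p.re + r + 1), le_max_left _ _, ?_⟩
    refine lt_of_lt_of_le ?_ (neg_re_le_infDist_halfLine _)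
    rw [hre, h1]
    linarith [le_max_right 0 (p.re + r + 1)]
  · have ha : 0 < |(R : ℂ).re| := abs_pos.2 h0
    refine ⟨(|p.im| + |r| + 1) / |(R : ℂ).re|, by positivity, ?_⟩
    refine lt_of_lt_of_le ?_ (abs_im_le_infDist_halfLine _)
    rw [him]
    have h2 : |(|p.im| + |r| + 1) / |(R : ℂ).re| * (R : ℂ).re| = |p.im| + |r| + 1 := by
      rw [abs_mul, abs_of_nonneg (a := _ / _) (by positivity)]
      field_simp
    have := abs_sub_abs_le_abs_sub ((|p.im| + |r| + 1) / |(R : ℂ).re| * (R : ℂ).re) p.im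
    rw [abs_sub_comm, h2] at this
    linarith [le_abs_self r]

/-- The complement of `Γ` is the disjoint union of the open sets `A` (all heights positive) and `K`
(some height negative), so each component lies in one of them. Components in `K` escape downwards in
some frame. The outside of a half-strip containing `Γ` is connected and contains points of `K`, so
it misses `A`, which is therefore close to the half-line. -/
theorem enclosedRegion_eq {R₁ R₂ R₃ : Circle} {u₁ u₂ u₃ : ℝ → ℝ} (hu₁ : Continuous u₁)
    (hu₂ : Continuous u₂) (hu₃ : Continuous u₃) {Γ : Set ℂ}
    (hR₁ : ((R₁⁻¹ : Circle) : ℂ) ≠ -Complex.I) (hR₂ : ((R₂⁻¹ : Circle) : ℂ) ≠ -Complex.I)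
    (hR₃ : ((R₃⁻¹ : Circle) : ℂ) ≠ -Complex.I)
    (hΓ : ∀ p, p ∈ Γ ↔ (0 ≤ gap R₁ u₁ p ∧ 0 ≤ gap R₂ u₂ p ∧ 0 ≤ gap R₃ u₃ p) ∧
      (gap R₁ u₁ p = 0 ∨ gap R₂ u₂ p = 0 ∨ gap R₃ u₃ p = 0))
    {r : ℝ} (hr0 : 0 ≤ r) (hr : ∀ p ∈ Γ, Metric.infDist p halfLine ≤ r)
    (hne : ∃ p, gap R₁ u₁ p < 0) :
    enclosedRegion halfLine Γ = {p | 0 < gap R₁ u₁ p ∧ 0 < gap R₂ u₂ p ∧ 0 < gap R₃ u₃ p} ∧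
    ∀ p, 0 < gap R₁ u₁ p → 0 < gap R₂ u₂ p → 0 < gap R₃ u₃ p →
      Metric.infDist p halfLine ≤ 2 * r := by
  have c₁ := continuous_gap (R := R₁) hu₁
  have c₂ := continuous_gap (R := R₂) hu₂
  have c₃ := continuous_gap (R := R₃) hu₃
  set A := {p | 0 < gap R₁ u₁ p ∧ 0 < gap R₂ u₂ p ∧ 0 < gap R₃ u₃ p} with hA
  set K := {p | gap R₁ u₁ p < 0 ∨ gap R₂ u₂ p < 0 ∨ gap R₃ u₃ p < 0} with hK
  have hAo : IsOpen A := (isOpen_lt continuous_const c₁).inter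
    ((isOpen_lt continuous_const c₂).inter (isOpen_lt continuous_const c₃))
  have hKo : IsOpen K := (isOpen_lt c₁ continuous_const).union
    ((isOpen_lt c₂ continuous_const).union (isOpen_lt c₃ continuous_const))
  have hAK : Disjoint A K := by
    rw [Set.disjoint_left]
    rintro p ⟨h1, h2, h3⟩ (h | h | h) <;> linarith
  have hcompl : ∀ p, p ∉ Γ → p ∈ A ∨ p ∈ K := by
    intro p hp
    rw [hΓ] at hp
    simp only [hA, hK, mem_ofPred_eq]
    grind
  have hAΓ : ∀ p ∈ A, p ∉ Γ := by
    rintro p ⟨h1, h2, h3⟩ hp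
    rcases ((hΓ p).1 hp).2 with h | h | h <;> linarith
  have hfar : ∀ p ∈ K, ∀ s, ∃ q ∈ connectedComponentIn Γᶜ p, q ∈ K ∧ s < Metric.infDist q halfLine := by
    rintro p (h | h | h) s
    · obtain ⟨q, h1, h2, h3⟩ := exists_infDist_gt_of_gap_neg hR₁ h
        (fun q hq => ((hΓ q).1 hq).1.1) s
      exact ⟨q, h1, .inl h2, h3⟩
    · obtain ⟨q, h1, h2, h3⟩ := exists_infDist_gt_of_gap_neg hR₂ h
        (fun q hq => ((hΓ q).1 hq).1.2.1) s
      exact ⟨q, h1, .inr (.inl h2), h3⟩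
    · obtain ⟨q, h1, h2, h3⟩ := exists_infDist_gt_of_gap_neg hR₃ h
        (fun q hq => ((hΓ q).1 hq).1.2.2) s
      exact ⟨q, h1, .inr (.inr h2), h3⟩
  have hbd : ∀ p ∈ A, Metric.infDist p halfLine ≤ 2 * r := by
    intro p hp
    by_contra! hcon
    obtain ⟨p₁, hp₁⟩ := hne
    obtain ⟨q, -, hqK, hq⟩ := hfar p₁ (.inl hp₁) (2 * r)
    have hsub : outsideStrip r ⊆ A ∪ K := fun z hz => hcompl z fun hzΓ => by
      have h1 := hr z hzΓ
      have h2 := abs_le.1 ((abs_im_le_infDist_halfLine z).trans h1)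
      have h3 := (neg_re_le_infDist_halfLine z).trans h1
      rcases hz with h | h | h <;> linarith [h2.1, h2.2]
    have := (isPreconnected_outsideStrip r).subset_left_of_subset_union hAo hKo hAK hsub
      ⟨p, mem_outsideStrip_of_lt_infDist hr0 hcon, hp⟩
    exact Set.disjoint_left.1 hAK (this (mem_outsideStrip_of_lt_infDist hr0 hq)) hqK
  refine ⟨?_, fun p h1 h2 h3 => hbd p ⟨h1, h2, h3⟩⟩
  ext p
  constructor
  · rintro ⟨hp, s, hs⟩
    refine (hcompl p hp).resolve_right fun hpK => ?_
    obtain ⟨q, h1, -, h2⟩ := hfar p hpK s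
    exact (hs q h1).not_gt h2
  · intro hp
    refine ⟨hAΓ p hp, 2 * r, fun q hq => hbd q ?_⟩
    exact isPreconnected_connectedComponentIn.subset_left_of_subset_union hAo hKo hAK
      ((connectedComponentIn_subset _ _).trans hcompl)
      ⟨p, mem_connectedComponentIn (hAΓ p hp), hp⟩ hq

end Region

/-! ### The angle at a vertex as a turning integral -/

section Angle

theorem exp_arctan_mul_I (k : ℝ) :
    Complex.exp (Real.arctan k * Complex.I) * (√(1 + k ^ 2) : ℝ) = 1 + k * Complex.I := by
  have h : 0 < √(1 + k ^ 2) := Real.sqrt_pos.2 (by positivity)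
  rw [Complex.exp_mul_I, ← Complex.ofReal_cos, ← Complex.ofReal_sin, Real.cos_arctan,
    Real.sin_arctan]
  have h' : ((√(1 + k ^ 2) : ℝ) : ℂ) ≠ 0 := by exact_mod_cast h.ne'
  push_cast
  field_simp

theorem exp_arctan_div_mul_I {R : Circle} (h : 0 < (R : ℂ).re) :
    Complex.exp (Real.arctan ((R : ℂ).im / (R : ℂ).re) * Complex.I) = R := by
  have h1 : √(1 + ((R : ℂ).im / (R : ℂ).re) ^ 2) = ((R : ℂ).re)⁻¹ := by
    rw [Real.sqrt_eq_iff_mul_self_eq (by positivity) (by positivity)]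
    have := re_sq_add_im_sq R
    field_simp
    linarith
  have h2 := exp_arctan_mul_I ((R : ℂ).im / (R : ℂ).re)
  have h' : ((R : ℂ).re : ℂ) ≠ 0 := by exact_mod_cast h.ne'
  rw [h1, Complex.ofReal_inv, ← div_eq_mul_inv, div_eq_iff h'] at h2
  rw [h2]
  push_cast
  field_simp
  rw [Complex.re_add_im]

theorem exp_neg_pi_div_two_mul_I : Complex.exp ((-(π / 2) : ℝ) * Complex.I) = -Complex.I := by
  rw [Complex.exp_mul_I, ← Complex.ofReal_cos, ← Complex.ofReal_sin]
  simp

theorem exp_three_pi_div_two_mul_I : Complex.exp ((3 * π / 2 : ℝ) * Complex.I) = -Complex.I := by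
  have : (3 * π / 2 : ℝ) = π / 2 + π := by ring
  rw [this, Complex.exp_mul_I, ← Complex.ofReal_cos, ← Complex.ofReal_sin, Real.cos_add_pi,
    Real.sin_add_pi]
  simp

/-- A continuous argument of a direction that never points straight down stays between
`-π / 2` and `3 π / 2`, also in the limit. -/
theorem mem_Ioo_of_tendsto_of_exp_ne {f : ℝ → ℝ} (hf : Continuous f) {x₀ a : ℝ}
    (h0 : f x₀ ∈ Ioo (-(π / 2)) (3 * π / 2))
    (h : ∀ x, x₀ < x → Complex.exp (f x * Complex.I) ≠ -Complex.I)
    (ha : Tendsto f atTop (𝓝 a)) (ha' : Complex.exp (a * Complex.I) ≠ -Complex.I) :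
    a ∈ Ioo (-(π / 2)) (3 * π / 2) := by
  have hx : ∀ x, x₀ ≤ x → f x ∈ Icc (-(π / 2)) (3 * π / 2) := by
    intro x hx
    by_contra hcon
    rw [mem_Icc, not_and_or, not_le, not_le] at hcon
    rcases hcon with hcon | hcon
    · obtain ⟨z, hz, hfz⟩ := intermediate_value_Icc' hx hf.continuousOn ⟨hcon.le, h0.1.le⟩
      have hz' : x₀ < z := hz.1.lt_of_ne (by rintro rfl; exact h0.1.ne' hfz)
      exact h z hz' (by rw [hfz, exp_neg_pi_div_two_mul_I])
    · obtain ⟨z, hz, hfz⟩ := intermediate_value_Icc hx hf.continuousOn ⟨h0.2.le, hcon.le⟩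
      have hz' : x₀ < z := hz.1.lt_of_ne (by rintro rfl; exact h0.2.ne hfz)
      exact h z hz' (by rw [hfz, exp_three_pi_div_two_mul_I])
  have hmem := isClosed_Icc.mem_of_tendsto ha ((eventually_ge_atTop x₀).mono hx)
  refine ⟨hmem.1.lt_of_ne ?_, hmem.2.lt_of_ne ?_⟩
  · rintro rfl; exact ha' exp_neg_pi_div_two_mul_I
  · rintro rfl; exact ha' exp_three_pi_div_two_mul_I

variable {R S : Circle} {u v : ℝ → ℝ}

/-- A rotated graph approaching the half-line is asymptotic, in its frame, to the half-line. -/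
theorem ApproachesHalfLine.tendsto_div (h : ApproachesHalfLine (graphPoint R u)) :
    0 < ((R⁻¹ : Circle) : ℂ).re ∧ Tendsto (fun x => u x / x) atTop
      (𝓝 (((R⁻¹ : Circle) : ℂ).im / ((R⁻¹ : Circle) : ℂ).re)) := by
  obtain ⟨A, hA⟩ : ∃ A, A = ((R⁻¹ : Circle) : ℂ).re := ⟨_, rfl⟩
  obtain ⟨B, hB⟩ : ∃ B, B = ((R⁻¹ : Circle) : ℂ).im := ⟨_, rfl⟩
  have hAB : A ^ 2 + B ^ 2 = 1 := by rw [hA, hB, re_sq_add_im_sq]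
  have hx : ∀ x, x = A * (graphPoint R u x).re - B * (graphPoint R u x).im := fun x => by
    have := congrArg Complex.re (inv_mul_graphPoint (R := R) (u := u) (x := x))
    rw [Complex.mul_re, ← hA, ← hB] at this
    simpa using this.symm
  have hy : ∀ x, u x = A * (graphPoint R u x).im + B * (graphPoint R u x).re := fun x => by
    have := congrArg Complex.im (inv_mul_graphPoint (R := R) (u := u) (x := x))
    rw [Complex.mul_im, ← hA, ← hB] at this
    simpa using this.symm
  rw [← hA, ← hB]
  have hBim : Tendsto (fun x => B * (graphPoint R u x).im) atTop (𝓝 0) := by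
    simpa using h.im.const_mul B
  have hA0 : 0 < A := by
    by_contra! hcon
    obtain ⟨x, h1, h2, h3⟩ := ((h.re.eventually_ge_atTop 0).and
      ((hBim.eventually (lt_mem_nhds (show (-1 : ℝ) < 0 by norm_num))).and
      (eventually_ge_atTop 1))).exists
    have := mul_nonpos_of_nonpos_of_nonneg hcon h1
    linarith [hx x]
  refine ⟨hA0, ?_⟩
  have h1 : Tendsto (fun x => B / A + (graphPoint R u x).im * (x⁻¹ / A)) atTop (𝓝 (B / A)) := by
    have h2 := h.im.mul (tendsto_inv_atTop_zero.div_const A)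
    simpa using h2.const_add (B / A)
  refine h1.congr' ?_
  filter_upwards [eventually_gt_atTop 0] with x hx0
  have h2 : A * u x = B * x + (graphPoint R u x).im := by
    linear_combination A * hy x - B * hx x + (graphPoint R u x).im * hAB
  field_simp
  linarith

theorem ApproachesHalfLine.tendsto_deriv (h : ApproachesHalfLine (graphPoint R u))
    (hu : IsExpanderSolution u) : Tendsto (deriv u) atTop
      (𝓝 (((R⁻¹ : Circle) : ℂ).im / ((R⁻¹ : Circle) : ℂ).re)) := by
  have h1 : Tendsto (fun x => support u x / x) atTop (𝓝 0) := by
    have : Tendsto (fun x => |u 0| * x⁻¹) atTop (𝓝 0) := by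
      simpa using tendsto_inv_atTop_zero.const_mul |u 0|
    refine squeeze_zero_norm' ?_ this
    filter_upwards [eventually_gt_atTop 0] with x hx
    rw [norm_div, Real.norm_eq_abs, Real.norm_eq_abs, abs_of_pos hx, div_eq_mul_inv]
    exact mul_le_mul_of_nonneg_right (hu.abs_support_le x) (inv_nonneg.2 hx.le)
  have h2 := h.tendsto_div.2.sub h1
  rw [sub_zero] at h2
  refine h2.congr' ?_
  filter_upwards [eventually_gt_atTop 0] with x hx
  rw [support]
  field_simp
  ring

theorem graphPoint_sub (R : Circle) (u : ℝ → ℝ) (x₀ x : ℝ) :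
    graphPoint R u x = graphPoint R u x₀ +
      (x - x₀ : ℝ) * (R * (1 + ((dslope u x₀ x : ℝ) : ℂ) * Complex.I)) := by
  have h : (x - x₀) * dslope u x₀ x = u x - u x₀ := by
    simpa using sub_smul_dslope u x₀ x
  have h' : ((x - x₀ : ℝ) : ℂ) * ((dslope u x₀ x : ℝ) : ℂ) = u x - u x₀ := by
    rw [← Complex.ofReal_mul, h]
    simp
  rw [graphPoint, graphPoint]
  push_cast at h' ⊢
  linear_combination -(R * Complex.I) * h'

theorem graphTangent_ne_zero (R : Circle) (u : ℝ → ℝ) (x : ℝ) : graphTangent R u x ≠ 0 := by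
  refine mul_ne_zero R.coe_ne_zero fun h => ?_
  have := congrArg Complex.re h
  simp at this

/-- In the frame of `S`, the tangent at the vertex has argument the angle plus `arctan (deriv v
y₀)`. Adding the turning of the arm gives an argument `κ` of the half-line direction `S⁻¹`. The
point is that `κ` lands in a fixed interval of length `2π`, so it does not depend on the arm. -/
theorem exists_angle_eq (hu : IsExpanderSolution u) (hv : IsExpanderSolution v) {x₀ y₀ : ℝ}
    (hp : graphPoint R u x₀ = graphPoint S v y₀)
    (hpos : ∀ x, x₀ < x → 0 < gap S v (graphPoint R u x)) (hs : 0 < gapSlope S v R u x₀)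
    (hR : ApproachesHalfLine (graphPoint R u)) :
    ∃ κ ∈ Ioo (-(π / 2)) (3 * π / 2), Complex.exp (κ * Complex.I) = (S⁻¹ : Circle) ∧
      InnerProductGeometry.angle (graphTangent R u x₀) (graphTangent S v y₀) =
        κ - (∫ x in Ioi x₀, support u x) - Real.arctan (deriv v y₀) := by
  rw [gapSlope_of_graphPoint_eq hp] at hs
  set T := graphTangent R u x₀ with hT
  set W := graphTangent S v y₀ with hW
  have hT0 : T ≠ 0 := graphTangent_ne_zero _ _ _
  have hW0 : W ≠ 0 := graphTangent_ne_zero _ _ _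
  set α := (T / W).arg with hα
  have him : 0 < (T / W).im := by
    have h1 : T / W = ((Complex.normSq W)⁻¹ : ℝ) * (starRingEnd ℂ W * T) := by
      rw [div_eq_mul_inv, Complex.inv_def]
      ring
    rw [h1, Complex.im_ofReal_mul]
    exact mul_pos (inv_pos.2 (Complex.normSq_pos.2 hW0)) hs
  have hα0 : 0 < α := (Complex.arg_nonneg_iff.2 him.le).lt_of_ne fun h =>
    him.ne' (Complex.arg_eq_zero_iff.1 h.symm).2
  have hαπ : α < π := Complex.arg_lt_pi_iff.2 (.inr him.ne')
  have hangle : InnerProductGeometry.angle T W = α := by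
    rw [Complex.angle_eq_abs_arg hT0 hW0, abs_of_pos hα0]
  set β := Real.arctan (deriv v y₀) with hβ
  -- `δ` is the lift of the argument of `S⁻¹ R` dictated by the angle at the vertex.
  set δ := α + β - Real.arctan (deriv u x₀) with hδ
  have hexpδ : Complex.exp (δ * Complex.I) = ((S⁻¹ * R : Circle) : ℂ) := by
    have e1 := exp_arctan_mul_I (deriv u x₀)
    have e2 := exp_arctan_mul_I (deriv v y₀)
    have e3 : (‖T / W‖ : ℂ) * Complex.exp (α * Complex.I) = T / W :=
      Complex.norm_mul_exp_arg_mul_I _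
    have hn : ∀ k : ℝ, ‖(1 + k * Complex.I : ℂ)‖ = √(1 + k ^ 2) := fun k => by
      rw [← exp_arctan_mul_I k, norm_mul, Complex.norm_exp_ofReal_mul_I, one_mul,
        Complex.norm_real, Real.norm_of_nonneg (Real.sqrt_nonneg _)]
    have e4 : ‖T / W‖ = √(1 + deriv u x₀ ^ 2) / √(1 + deriv v y₀ ^ 2) := by
      rw [norm_div, hT, hW, graphTangent, graphTangent, norm_mul, norm_mul, Circle.norm_coe,
        Circle.norm_coe, hn, hn, one_mul, one_mul]
    have p1 : ((√(1 + deriv u x₀ ^ 2) : ℝ) : ℂ) ≠ 0 := by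
      exact_mod_cast (Real.sqrt_pos.2 (by positivity)).ne'
    have p2 : ((√(1 + deriv v y₀ ^ 2) : ℝ) : ℂ) ≠ 0 := by
      exact_mod_cast (Real.sqrt_pos.2 (by positivity)).ne'
    have hS : (S : ℂ) ≠ 0 := S.coe_ne_zero
    have q1 := Complex.exp_ne_zero (Real.arctan (deriv u x₀) * Complex.I)
    have q2 := Complex.exp_ne_zero (Real.arctan (deriv v y₀) * Complex.I)
    rw [e4, hT, hW, graphTangent, graphTangent, ← e1, ← e2] at e3
    have e5 : Complex.exp (δ * Complex.I) * Complex.exp (Real.arctan (deriv u x₀) * Complex.I) =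
        Complex.exp (α * Complex.I) * Complex.exp (Real.arctan (deriv v y₀) * Complex.I) := by
      rw [← Complex.exp_add, ← Complex.exp_add, hδ, hβ]
      congr 1
      push_cast
      ring
    rw [Circle.coe_mul, Circle.coe_inv]
    refine mul_right_cancel₀ q1 ?_
    rw [e5]
    rw [Complex.ofReal_div] at e3
    field_simp at e3 ⊢
    linear_combination e3
  have hd : Continuous (dslope u x₀) := by
    rw [← continuousOn_univ, continuousOn_dslope univ_mem]
    exact ⟨hu.continuous.continuousOn, (hu.hasDerivAt x₀).differentiableAt⟩
  have hL := Real.continuous_arctan.continuousAt.tendsto.comp (hR.tendsto_deriv hu)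
  obtain ⟨hre, hdiv⟩ := hR.tendsto_div
  set L := Real.arctan (((R⁻¹ : Circle) : ℂ).im / ((R⁻¹ : Circle) : ℂ).re) with hLdef
  have hint : ∫ x in Ioi x₀, support u x = L - Real.arctan (deriv u x₀) :=
    integral_Ioi_of_hasDerivAt_of_tendsto' (fun x _ => hu.hasDerivAt_arctan_deriv x)
      hu.integrable_support.integrableOn hL
  have hexpL : Complex.exp ((δ + L : ℝ) * Complex.I) = (S⁻¹ : Circle) := by
    rw [Complex.ofReal_add, add_mul, Complex.exp_add, hexpδ, exp_arctan_div_mul_I hre,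
      ← Circle.coe_mul, mul_assoc, mul_inv_cancel, mul_one]
  have hdlim : Tendsto (dslope u x₀) atTop
      (𝓝 (((R⁻¹ : Circle) : ℂ).im / ((R⁻¹ : Circle) : ℂ).re)) := by
    have h1 : Tendsto (fun x => (u x / x - u x₀ * x⁻¹) / (1 - x₀ * x⁻¹)) atTop
        (𝓝 ((((R⁻¹ : Circle) : ℂ).im / ((R⁻¹ : Circle) : ℂ).re - u x₀ * 0) / (1 - x₀ * 0))) :=
      (hdiv.sub (tendsto_inv_atTop_zero.const_mul _)).div
        ((tendsto_inv_atTop_zero.const_mul _).const_sub 1) (by simp)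
    rw [mul_zero, mul_zero, sub_zero, sub_zero, div_one] at h1
    refine h1.congr' ?_
    filter_upwards [eventually_gt_atTop 0, eventually_gt_atTop x₀] with x hx hx'
    rw [dslope_of_ne _ hx'.ne', slope_def_field]
    have : x - x₀ ≠ 0 := (sub_pos.2 hx').ne'
    field_simp
  have hβ1 := Real.neg_pi_div_two_lt_arctan (deriv v y₀)
  have hβ2 := Real.arctan_lt_pi_div_two (deriv v y₀)
  refine ⟨δ + L, ?_, hexpL, ?_⟩
  -- The argument of the secant from the vertex is followed, rather than that of the tangent: a
  -- secant pointing straight down would put a point of the arm below the graph of `v`. At `x₀` the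
  -- secant is the tangent, with argument `α + β`, and at infinity it has the same limit as the
  -- tangent.
  · refine mem_Ioo_of_tendsto_of_exp_ne (f := fun x => δ + Real.arctan (dslope u x₀ x))
      (x₀ := x₀) (by fun_prop) ?_ ?_ ?_ ?_
    · simp only [dslope_same, hδ]
      constructor <;> linarith
    · intro x hx hexp
      have hk : 0 < √(1 + dslope u x₀ x ^ 2) := Real.sqrt_pos.2 (by positivity)
      have h1 : ((S⁻¹ * R : Circle) : ℂ) * (1 + ((dslope u x₀ x : ℝ) : ℂ) * Complex.I) =
          -((√(1 + dslope u x₀ x ^ 2) : ℝ) * Complex.I) := by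
        rw [← exp_arctan_mul_I, ← hexpδ, ← mul_assoc, ← Complex.exp_add, ← add_mul,
          ← Complex.ofReal_add, hexp]
        ring
      have h2 : ((S⁻¹ : Circle) : ℂ) * graphPoint R u x = y₀ + v y₀ * Complex.I
          - ((x - x₀) * √(1 + dslope u x₀ x ^ 2) : ℝ) * Complex.I := by
        rw [graphPoint_sub R u x₀ x, mul_add, hp, inv_mul_graphPoint, mul_left_comm,
          ← mul_assoc _ (R : ℂ), ← Circle.coe_mul, h1]
        push_cast
        ring
      have h3 := hpos x hx
      rw [gap, h2] at h3
      simp at h3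
      nlinarith [mul_pos (sub_pos.2 hx) hk]
    · exact (Real.continuous_arctan.continuousAt.tendsto.comp hdlim).const_add δ
    · rw [hexpL]
      exact hR.inv_ne_neg_I hv ((eventually_gt_atTop x₀).mono fun x hx => (hpos x hx).le)
  · rw [hangle, hint, hδ]
    ring

theorem eq_of_exp_mul_I_eq {a b : ℝ} (ha : a ∈ Ioo (-(π / 2)) (3 * π / 2))
    (hb : b ∈ Ioo (-(π / 2)) (3 * π / 2))
    (h : Complex.exp (a * Complex.I) = Complex.exp (b * Complex.I)) : a = b := by
  obtain ⟨n, hn⟩ := Complex.exp_eq_exp_iff_exists_int.1 h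
  have hn' : a = b + n * (2 * π) := by
    have h1 := congrArg Complex.im hn
    simp at h1
    linarith
  have hπ := Real.pi_pos
  have h1 : (n : ℝ) < 1 := by
    by_contra! hc
    nlinarith [ha.2, hb.1]
  have h2 : (-1 : ℝ) < n := by
    by_contra! hc
    nlinarith [ha.1, hb.2]
  have : n = 0 := by
    have h1' : n < 1 := by exact_mod_cast h1
    have h2' : -1 < n := by exact_mod_cast h2
    omega
  simpa [this] using hn'

end Angle

/-! ### Area and angles in normalized position -/

section Core

theorem ApproachesHalfLine.exists_infDist_le {c : ℝ → ℂ} (h : ApproachesHalfLine c) (s : ℝ) :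
    ∃ r, ∀ t, s ≤ t → Metric.infDist (c t) halfLine ≤ r := by
  obtain ⟨T, hT⟩ := eventually_atTop.1 ((h.re.eventually_ge_atTop 0).and
    (h.im.abs.eventually_lt_const (show |(0 : ℝ)| < 1 by simp)))
  obtain ⟨M, hM⟩ := (isCompact_Icc (a := s) (b := T)).exists_bound_of_continuousOn
    ((Metric.continuous_infDist_pt halfLine).comp h.continuous).continuousOn
  refine ⟨max M 1, fun t ht => ?_⟩
  rcases le_total t T with h' | h'
  · exact (le_abs_self _).trans ((hM t ⟨ht, h'⟩).trans (le_max_left _ _))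
  · obtain ⟨h1, h2⟩ := hT t h'
    refine (infDist_halfLine_le _).trans (le_trans ?_ (le_max_right _ _))
    rw [max_eq_right (by linarith)]
    linarith

/-- In this normalization the boundary is traversed with the triangle on its left: in from infinity
along the first graph, along the third from `y₁` to `y₂`, and out along the second. The first
tangent is negated because the arm leaves its vertex against the direction of the graph. -/
theorem area_eq_angle_sub_angle {R₁ R₂ R₃ : Circle} {u₁ u₂ u₃ : ℝ → ℝ}
    (h₁ : IsExpanderSolution u₁) (h₂ : IsExpanderSolution u₂) (h₃ : IsExpanderSolution u₃)
    {x₁ x₂ y₁ y₂ : ℝ} (hy : y₁ < y₂)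
    (hp₁ : graphPoint R₁ u₁ x₁ = graphPoint R₃ u₃ y₁)
    (hp₂ : graphPoint R₂ u₂ x₂ = graphPoint R₃ u₃ y₂)
    (h₁₂ : ∀ x, 0 < gap R₂ u₂ (graphPoint R₁ u₁ x))
    (h₂₁ : ∀ x, 0 < gap R₁ u₁ (graphPoint R₂ u₂ x))
    (h₁₃ : StrictAnti fun x => gap R₃ u₃ (graphPoint R₁ u₁ x))
    (h₂₃ : StrictMono fun x => gap R₃ u₃ (graphPoint R₂ u₂ x))
    (h₃₁ : StrictMono fun x => gap R₁ u₁ (graphPoint R₃ u₃ x))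
    (h₃₂ : StrictAnti fun x => gap R₂ u₂ (graphPoint R₃ u₃ x))
    (hs₁ : gapSlope R₃ u₃ R₁ u₁ x₁ < 0) (hs₂ : 0 < gapSlope R₃ u₃ R₂ u₂ x₂)
    (ha₁ : ApproachesHalfLine fun x => graphPoint R₁ u₁ (-x))
    (ha₂ : ApproachesHalfLine (graphPoint R₂ u₂)) {Γ : Set ℂ}
    (hΓ : Γ = graphPoint R₁ u₁ '' Iic x₁ ∪ graphPoint R₂ u₂ '' Ici x₂ ∪
      graphPoint R₃ u₃ '' Icc y₁ y₂) :
    volume (enclosedRegion halfLine Γ) < ⊤ ∧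
      InnerProductGeometry.angle (graphTangent R₂ u₂ x₂) (graphTangent R₃ u₃ y₂) -
        InnerProductGeometry.angle (-graphTangent R₁ u₁ x₁) (graphTangent R₃ u₃ y₁) =
      2 * volume.real (enclosedRegion halfLine Γ) := by
  have z₁₃ : gap R₃ u₃ (graphPoint R₁ u₁ x₁) = 0 := by rw [hp₁, gap_graphPoint]
  have z₂₃ : gap R₃ u₃ (graphPoint R₂ u₂ x₂) = 0 := by rw [hp₂, gap_graphPoint]
  have z₃₁ : gap R₁ u₁ (graphPoint R₃ u₃ y₁) = 0 := by rw [← hp₁, gap_graphPoint]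
  have z₃₂ : gap R₂ u₂ (graphPoint R₃ u₃ y₂) = 0 := by rw [← hp₂, gap_graphPoint]
  have p₁₃ : ∀ x, 0 < gap R₃ u₃ (graphPoint R₁ u₁ x) ↔ x < x₁ := fun x => by
    rw [← z₁₃]; exact h₁₃.lt_iff_gt
  have p₂₃ : ∀ x, 0 < gap R₃ u₃ (graphPoint R₂ u₂ x) ↔ x₂ < x := fun x => by
    rw [← z₂₃]; exact h₂₃.lt_iff_lt
  have p₃₁ : ∀ x, 0 < gap R₁ u₁ (graphPoint R₃ u₃ x) ↔ y₁ < x := fun x => by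
    rw [← z₃₁]; exact h₃₁.lt_iff_lt
  have p₃₂ : ∀ x, 0 < gap R₂ u₂ (graphPoint R₃ u₃ x) ↔ x < y₂ := fun x => by
    rw [← z₃₂]; exact h₃₂.lt_iff_gt
  have q₁₃ : ∀ x, 0 ≤ gap R₃ u₃ (graphPoint R₁ u₁ x) ↔ x ≤ x₁ := fun x => by
    rw [← z₁₃]; exact h₁₃.le_iff_ge
  have q₂₃ : ∀ x, 0 ≤ gap R₃ u₃ (graphPoint R₂ u₂ x) ↔ x₂ ≤ x := fun x => by
    rw [← z₂₃]; exact h₂₃.le_iff_le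
  have q₃₁ : ∀ x, 0 ≤ gap R₁ u₁ (graphPoint R₃ u₃ x) ↔ y₁ ≤ x := fun x => by
    rw [← z₃₁]; exact h₃₁.le_iff_le
  have q₃₂ : ∀ x, 0 ≤ gap R₂ u₂ (graphPoint R₃ u₃ x) ↔ x ≤ y₂ := fun x => by
    rw [← z₃₂]; exact h₃₂.le_iff_ge
  have hΓ' : ∀ p, p ∈ Γ ↔ (0 ≤ gap R₁ u₁ p ∧ 0 ≤ gap R₂ u₂ p ∧ 0 ≤ gap R₃ u₃ p) ∧
      (gap R₁ u₁ p = 0 ∨ gap R₂ u₂ p = 0 ∨ gap R₃ u₃ p = 0) := by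
    intro p
    rw [hΓ]
    constructor
    · rintro ((⟨x, hx, rfl⟩ | ⟨x, hx, rfl⟩) | ⟨x, hx, rfl⟩)
      · exact ⟨⟨gap_graphPoint.ge, (h₁₂ x).le, (q₁₃ x).2 hx⟩, .inl gap_graphPoint⟩
      · exact ⟨⟨(h₂₁ x).le, gap_graphPoint.ge, (q₂₃ x).2 hx⟩, .inr (.inl gap_graphPoint)⟩
      · exact ⟨⟨(q₃₁ x).2 hx.1, (q₃₂ x).2 hx.2, gap_graphPoint.ge⟩, .inr (.inr gap_graphPoint)⟩
    · rintro ⟨⟨g₁, g₂, g₃⟩, h | h | h⟩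
      · obtain ⟨x, rfl⟩ := gap_eq_zero_iff.1 h
        exact .inl (.inl ⟨x, (q₁₃ x).1 g₃, rfl⟩)
      · obtain ⟨x, rfl⟩ := gap_eq_zero_iff.1 h
        exact .inl (.inr ⟨x, (q₂₃ x).1 g₃, rfl⟩)
      · obtain ⟨x, rfl⟩ := gap_eq_zero_iff.1 h
        exact .inr ⟨x, ⟨(q₃₁ x).1 g₁, (q₃₂ x).1 g₂⟩, rfl⟩
  obtain ⟨r, hr0, hr⟩ : ∃ r, 0 ≤ r ∧ ∀ p ∈ Γ, Metric.infDist p halfLine ≤ r := by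
    obtain ⟨r₁, hr₁⟩ := ha₁.exists_infDist_le (-x₁)
    obtain ⟨r₂, hr₂⟩ := ha₂.exists_infDist_le x₂
    obtain ⟨r₃, hr₃⟩ := (isCompact_Icc (a := y₁) (b := y₂)).exists_bound_of_continuousOn
      ((Metric.continuous_infDist_pt halfLine).comp
        (continuous_graphPoint (R := R₃) h₃.continuous)).continuousOn
    refine ⟨max r₁ (max r₂ r₃), ?_, ?_⟩
    · exact Metric.infDist_nonneg.trans ((hr₂ x₂ le_rfl).trans
        ((le_max_left _ _).trans (le_max_right _ _)))
    · rw [hΓ]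
      rintro _ ((⟨x, hx, rfl⟩ | ⟨x, hx, rfl⟩) | ⟨x, hx, rfl⟩)
      · have := hr₁ (-x) (neg_le_neg hx)
        rw [neg_neg] at this
        exact this.trans (le_max_left _ _)
      · exact (hr₂ x hx).trans ((le_max_left _ _).trans (le_max_right _ _))
      · exact (le_abs_self _).trans ((hr₃ x hx).trans
          ((le_max_right _ _).trans (le_max_right _ _)))
  have hR₁ := ha₁.inv_ne_neg_I (R := R₁) h₁ (.of_forall fun x => gap_graphPoint.ge)
  have hR₂ := ha₂.inv_ne_neg_I (R := R₂) h₂ (.of_forall fun x => gap_graphPoint.ge)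
  have hR₃ := ha₂.inv_ne_neg_I (R := R₃) h₃
    ((eventually_ge_atTop x₂).mono fun x hx => (q₂₃ x).2 hx)
  obtain ⟨hA, hbd⟩ := enclosedRegion_eq h₁.continuous h₂.continuous h₃.continuous hR₁ hR₂ hR₃
    -- Any point of the third graph before its vertex `y₁` lies below the first graph.
    hΓ' hr0 hr ⟨graphPoint R₃ u₃ (y₁ - 1), z₃₁ ▸ h₃₁ (sub_one_lt y₁)⟩
  obtain ⟨hfin, harea⟩ := area_of_three_graphs (R₁ := R₁) (R₂ := R₂) (R₃ := R₃) h₁ h₂ h₃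
    (q₁ := graphPoint R₁ u₁ x₁) (q₂ := graphPoint R₂ u₂ x₂) (r := 2 * r)
    (fun p h h' => by
      obtain ⟨x, rfl⟩ := gap_eq_zero_iff.1 h
      exact (h₁₂ x).ne' h')
    (fun p h h' => by
      obtain ⟨x, rfl⟩ := gap_eq_zero_iff.1 h
      rw [h₁₃.injective (h'.trans z₁₃.symm)])
    (fun p h h' => by
      obtain ⟨x, rfl⟩ := gap_eq_zero_iff.1 h
      rw [h₂₃.injective (h'.trans z₂₃.symm)])
    (fun p g₁ g₂ g₃ => (abs_im_le_infDist_halfLine p).trans (hbd p g₁ g₂ g₃))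
    (measurableSet_Iio (a := x₁)) (measurableSet_Ioi (a := x₂)) (measurableSet_Ioo (a := y₁) (b := y₂))
    (fun x => (and_iff_right (h₁₂ x)).trans (p₁₃ x))
    (fun x => (and_iff_right (h₂₁ x)).trans (p₂₃ x))
    (fun x => and_congr (p₃₁ x) (p₃₂ x))
  rw [← hA] at hfin harea
  refine ⟨hfin, ?_⟩
  obtain ⟨κ₂, m₂, e₂, k₂⟩ := exists_angle_eq h₂ h₃ hp₂ (fun x hx => (p₂₃ x).2 hx) hs₂ ha₂
  have hp₁' : graphPoint (-R₁) (fun x => -u₁ (-x)) (-x₁) = graphPoint R₃ u₃ y₁ := by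
    rw [graphPoint_flip, neg_neg, hp₁]
  obtain ⟨κ₁, m₁, e₁, k₁⟩ := exists_angle_eq (R := -R₁) (x₀ := -x₁) h₁.flip h₃ hp₁'
    (fun x hx => by
      rw [graphPoint_flip]
      exact (p₁₃ _).2 (by linarith))
    (by
      rw [gapSlope_of_graphPoint_eq hp₁', graphTangent_flip, neg_neg, mul_neg, Complex.neg_im,
        ← gapSlope_of_graphPoint_eq hp₁]
      exact neg_pos.2 hs₁)
    (by
      have : graphPoint (-R₁) (fun x => -u₁ (-x)) = fun x => graphPoint R₁ u₁ (-x) :=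
        funext fun x => graphPoint_flip R₁ u₁ x
      rwa [this])
  -- Both are arguments of `R₃⁻¹` in the same open interval of length `2π`, so no multiple of `2π`
  -- intervenes.
  have hκ : κ₁ = κ₂ := eq_of_exp_mul_I_eq m₁ m₂ (e₁.trans e₂.symm)
  have hi₁ : ∫ x in Ioi (-x₁), support (fun x => -u₁ (-x)) x = -∫ x in Iio x₁, support u₁ x := by
    simp_rw [support_flip]
    rw [integral_neg, integral_comp_neg_Ioi (-x₁) (support u₁), neg_neg,
      integral_Iic_eq_integral_Iio]
  have hi₃ : ∫ x in Ioo y₁ y₂, support u₃ x =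
      Real.arctan (deriv u₃ y₂) - Real.arctan (deriv u₃ y₁) := by
    rw [← integral_Ioc_eq_integral_Ioo, ← intervalIntegral.integral_of_le hy.le]
    exact intervalIntegral.integral_eq_sub_of_hasDerivAt
      (fun x _ => h₃.hasDerivAt_arctan_deriv x) (h₃.continuous_support.intervalIntegrable _ _)
  rw [graphTangent_flip, neg_neg, hi₁] at k₁
  rw [harea, k₂, k₁, hi₃, hκ]
  ring

end Core

/-! ### Regular parametrizations, orientations and crossings -/

/-- `c` is the regular reparametrization by `φ` of the graph of the expander `u`, rotated by `R`. -/
structure IsGraphCurve (R : Circle) (u φ : ℝ → ℝ) (c : ℝ → ℂ) : Prop where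
  sol : IsExpanderSolution u
  contDiff : ContDiff ℝ 1 φ
  deriv_ne : ∀ t, deriv φ t ≠ 0
  surj : Function.Surjective φ
  eq : ∀ t, c t = graphPoint R u (φ t)

namespace IsGraphCurve

variable {R S : Circle} {u v φ ψ : ℝ → ℝ} {c d : ℝ → ℂ}

theorem flip (h : IsGraphCurve R u φ c) :
    IsGraphCurve (-R) (fun x => -u (-x)) (fun t => -φ t) c where
  sol := h.sol.flip
  contDiff := h.contDiff.neg
  deriv_ne t := by
    rw [deriv.fun_neg]
    exact neg_ne_zero.2 (h.deriv_ne t)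
  surj := neg_surjective.comp h.surj
  eq t := by rw [graphPoint_flip, neg_neg, h.eq]

theorem rotation_comp (h : IsGraphCurve R u φ c) (Q : Circle) (hd : ∀ t, d t = rotation Q (c t)) :
    IsGraphCurve (Q * R) u φ d where
  sol := h.sol
  contDiff := h.contDiff
  deriv_ne := h.deriv_ne
  surj := h.surj
  eq t := by rw [hd, h.eq, rotation_apply, graphPoint, graphPoint, Circle.coe_mul, mul_assoc]

theorem hasDerivAt_param (h : IsGraphCurve R u φ c) (t : ℝ) : HasDerivAt φ (deriv φ t) t :=
  (h.contDiff.differentiable (by norm_num) t).hasDerivAt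

theorem mono_or_anti (h : IsGraphCurve R u φ c) :
    ((∀ t, 0 < deriv φ t) ∧ StrictMono φ) ∨ ((∀ t, deriv φ t < 0) ∧ StrictAnti φ) :=
  strictMono_or_strictAnti_of_hasDerivAt_ne_zero h.hasDerivAt_param
    (h.contDiff.continuous_deriv (by norm_num)) h.deriv_ne

theorem deriv_eq (h : IsGraphCurve R u φ c) (t : ℝ) :
    deriv c t = deriv φ t • graphTangent R u (φ t) := by
  have hc : c = fun t => (R : ℂ) * (φ t + u (φ t) * Complex.I) := funext h.eq
  have h1 := (h.hasDerivAt_param t).ofReal_comp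
  have h2 := ((h.sol.hasDerivAt (φ t)).comp t (h.hasDerivAt_param t)).ofReal_comp
  have h3 := (h1.add (h2.mul_const Complex.I)).const_mul (R : ℂ)
  rw [hc]
  refine h3.deriv.trans ?_
  rw [graphTangent, Complex.real_smul]
  push_cast
  ring

theorem continuous (h : IsGraphCurve R u φ c) : Continuous c := by
  have : c = graphPoint R u ∘ φ := funext h.eq
  rw [this]
  exact (continuous_graphPoint h.sol.continuous).comp h.contDiff.continuous

theorem gap_eq_zero (h : IsGraphCurve R u φ c) (t : ℝ) : gap R u (c t) = 0 := by
  rw [h.eq, gap_graphPoint]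

theorem image_eq (h : IsGraphCurve R u φ c) (s : Set ℝ) : c '' s = graphPoint R u '' (φ '' s) := by
  rw [image_image]
  exact image_congr fun t _ => h.eq t

theorem range_eq (h : IsGraphCurve R u φ c) : range c = range (graphPoint R u) := by
  rw [← image_univ, h.image_eq, image_univ, h.surj.range_eq, image_univ]

theorem image_Ici_of_strictMono (h : IsGraphCurve R u φ c) (hφ : StrictMono φ) (s : ℝ) :
    c '' Ici s = graphPoint R u '' Ici (φ s) := by
  rw [h.image_eq]
  exact congrArg _ ((hφ.orderIsoOfSurjective φ h.surj).image_Ici s)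

theorem image_Icc_of_strictMono (h : IsGraphCurve R u φ c) (hφ : StrictMono φ) (s t : ℝ) :
    c '' Icc s t = graphPoint R u '' Icc (φ s) (φ t) := by
  rw [h.image_eq]
  exact congrArg _ ((hφ.orderIsoOfSurjective φ h.surj).image_Icc s t)

theorem image_Ici_of_strictAnti (h : IsGraphCurve R u φ c) (hφ : StrictAnti φ) (s : ℝ) :
    c '' Ici s = graphPoint R u '' Iic (φ s) := by
  rw [h.flip.image_Ici_of_strictMono hφ.neg, ← image_neg_Iic, image_image]
  exact image_congr fun x _ => by rw [graphPoint_flip, neg_neg]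

theorem image_Icc_of_strictAnti (h : IsGraphCurve R u φ c) (hφ : StrictAnti φ) (s t : ℝ) :
    c '' Icc s t = graphPoint R u '' Icc (φ t) (φ s) := by
  rw [h.flip.image_Icc_of_strictMono hφ.neg, ← image_neg_Icc, image_image]
  exact image_congr fun x _ => by rw [graphPoint_flip, neg_neg]

theorem approaches_of_strictMono (h : IsGraphCurve R u φ c) (hφ : StrictMono φ)
    (hc : ApproachesHalfLine c) : ApproachesHalfLine (graphPoint R u) := by
  set e := hφ.orderIsoOfSurjective φ h.surj
  have he : graphPoint R u = fun x => c (e.symm x) := funext fun x => by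
    rw [h.eq]
    exact congrArg _ (e.apply_symm_apply x).symm
  refine ⟨continuous_graphPoint h.sol.continuous, ?_, ?_⟩
  · rw [he]; exact hc.re.comp e.symm.tendsto_atTop
  · rw [he]; exact hc.im.comp e.symm.tendsto_atTop

theorem approaches_of_strictAnti (h : IsGraphCurve R u φ c) (hφ : StrictAnti φ)
    (hc : ApproachesHalfLine c) : ApproachesHalfLine fun x => graphPoint R u (-x) := by
  have := h.flip.approaches_of_strictMono hφ.neg hc
  have he : graphPoint (-R) (fun x => -u (-x)) = fun x => graphPoint R u (-x) :=
    funext fun x => graphPoint_flip R u x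
  rwa [he] at this

theorem tendsto_norm (h : IsGraphCurve R u φ c) : Tendsto (fun t => ‖c t‖) atTop atTop := by
  have h1 : Tendsto (fun t => |φ t|) atTop atTop := by
    rcases h.mono_or_anti with ⟨-, hφ⟩ | ⟨-, hφ⟩
    · exact tendsto_abs_atTop_atTop.comp (hφ.orderIsoOfSurjective φ h.surj).tendsto_atTop
    · have := tendsto_abs_atTop_atTop.comp
        (hφ.neg.orderIsoOfSurjective _ (neg_surjective.comp h.surj)).tendsto_atTop
      refine this.congr fun t => ?_
      exact abs_neg (φ t)
  refine tendsto_atTop_mono (fun t => ?_) h1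
  rw [h.eq, graphPoint, norm_mul, Circle.norm_coe, one_mul]
  refine le_trans (le_of_eq ?_) (Complex.abs_re_le_norm _)
  simp

theorem approachesHalfLine (h : IsGraphCurve R u φ c)
    (ha : Tendsto (fun t => Metric.infDist (c t) halfLine) atTop (𝓝 0)) :
    ApproachesHalfLine c := by
  refine ⟨h.continuous, ?_, squeeze_zero_norm (fun t => abs_im_le_infDist_halfLine (c t)) ha⟩
  -- Within distance `1` of a point `y` of the half-line, both the norm and the real part of `c t`
  -- differ from `‖y‖ = y.re` by at most `1`; hence the constant `-2`.
  refine tendsto_atTop_mono' _ ?_ (tendsto_atTop_add_const_right _ (-2) h.tendsto_norm)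
  filter_upwards [ha.eventually_lt_const one_pos] with t ht
  obtain ⟨y, hy, hyt⟩ := (Metric.infDist_lt_iff halfLine_nonempty).1 ht
  rw [Complex.dist_eq] at hyt
  have h1 := (abs_le.1 (Complex.abs_re_le_norm (c t - y))).1
  rw [Complex.sub_re] at h1
  have h2 : ‖y‖ = y.re := by
    have : y = (y.re : ℂ) := by apply Complex.ext <;> simp [hy.2]
    rw [this, Complex.norm_real, Complex.ofReal_re, Real.norm_of_nonneg hy.1]
  have h3 := norm_sub_norm_le (c t) y
  linarith

/-- Two expanders asymptotic to the half-line coincide or are disjoint. -/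
theorem gap_eq_zero_or_ne_zero (h : IsGraphCurve R u φ c) (h' : IsGraphCurve S v ψ d)
    (hc : ApproachesHalfLine c) (hd : ApproachesHalfLine d) :
    (∀ x, gap S v (graphPoint R u x) = 0) ∨ ∀ x, gap S v (graphPoint R u x) ≠ 0 := by
  -- After a transversal crossing the height would stay bounded away from zero, although both curves
  -- approach the half-line.
  have hcon : ∀ s, gap S v (c s) = 0 → ((StrictMono fun t => gap S v (c t)) ∨
      StrictAnti fun t => gap S v (c t)) → False := by
    rintro s hs (hm | hm)
    · refine hc.not_separated hd h'.sol (hs ▸ hm (lt_add_one s))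
        ((eventually_ge_atTop (s + 1)).mono fun t ht => hm.monotone ht)
        (.of_forall fun t => (h'.gap_eq_zero t).le)
    · refine hd.not_separated hc h'.sol (hs ▸ hm (lt_add_one s))
        (.of_forall fun t => (h'.gap_eq_zero t).ge)
        ((eventually_ge_atTop (s + 1)).mono fun t ht => hm.antitone ht)
  by_cases h0 : ∃ x, gap S v (graphPoint R u x) = 0
  · obtain ⟨x, h0⟩ := h0
    obtain ⟨s, rfl⟩ := h.surj x
    rw [← h.eq] at h0
    have hfun : (fun t => gap S v (c t)) = (fun x => gap S v (graphPoint R u x)) ∘ φ :=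
      funext fun t => by rw [h.eq]; rfl
    rcases gap_graphPoint_dichotomy h.sol h'.sol R S with hz | hz | ⟨-, hz⟩ | ⟨-, hz⟩
    · exact .inl fun x => (hz x).1
    · exact absurd (h.eq s ▸ h0) (hz _)
    · refine (hcon s h0 ?_).elim
      rw [hfun]
      rcases h.mono_or_anti with ⟨-, hφ⟩ | ⟨-, hφ⟩
      exacts [.inl (hz.comp hφ), .inr (hz.comp_strictAnti hφ)]
    · refine (hcon s h0 ?_).elim
      rw [hfun]
      rcases h.mono_or_anti with ⟨-, hφ⟩ | ⟨-, hφ⟩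
      exacts [.inr (hz.comp_strictMono hφ), .inl (hz.comp hφ)]
  · push Not at h0
    exact .inr h0

theorem range_subset_of_gap_eq_zero (h : IsGraphCurve R u φ c) (h' : IsGraphCurve S v ψ d)
    (h0 : ∀ x, gap S v (graphPoint R u x) = 0) : range c ⊆ range d := by
  rw [h.range_eq, h'.range_eq]
  rintro _ ⟨x, rfl⟩
  exact gap_eq_zero_iff.1 (h0 x)

/-- The orientation of the frame may be chosen so that a given nonvanishing height is positive. -/
theorem exists_pos (h : IsGraphCurve S v ψ d) {f : ℝ → ℂ} (hf : Continuous f)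
    (h0 : ∀ x, gap S v (f x) ≠ 0) :
    ∃ S' v' ψ', IsGraphCurve S' v' ψ' d ∧ ∀ x, 0 < gap S' v' (f x) := by
  have hc : Continuous fun x => gap S v (f x) := (continuous_gap h.sol.continuous).comp hf
  by_cases hp : ∀ x, 0 < gap S v (f x)
  · exact ⟨S, v, ψ, h, hp⟩
  · push Not at hp
    obtain ⟨a, ha⟩ := hp
    refine ⟨_, _, _, h.flip, fun x => ?_⟩
    rw [gap_flip, neg_pos]
    by_contra! hx
    obtain ⟨z, hz⟩ := mem_range_of_exists_le_of_exists_ge hc ⟨a, ha⟩ ⟨x, hx⟩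
    exact h0 z hz

end IsGraphCurve

namespace IsExpandingCurveWithParam

variable {h h' : ℝ} {c c' : ℝ → ℂ}

theorem exists_isGraphCurve (hc : IsExpandingCurveWithParam h c) :
    ∃ R u φ, IsGraphCurve R u φ c := by
  obtain ⟨u, R, φ, hu, -, h1, h2, h3, h4⟩ := hc.expanding
  refine ⟨R, u, φ, hu, h1, h2, h3, fun t => ?_⟩
  rw [h4, rotation_apply, graphPoint]
  congr 1
  apply Complex.ext <;> simp

theorem param_eq_of_range_eq (hc : IsExpandingCurveWithParam h c)
    (hc' : IsExpandingCurveWithParam h' c') (hr : range c = range c') : h = h' := by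
  have habs : |h| = |h'| := by rw [← hc.dist_origin, ← hc'.dist_origin, hr]
  obtain ⟨t, ht⟩ : c 0 ∈ range c' := hr ▸ mem_range_self 0
  rcases abs_eq_abs.1 habs with e | e
  · exact e
  · rcases lt_trichotomy h 0 with hh | hh | hh
    · have h1 := hc.lower hh 0
      have h2 := hc'.upper (by linarith) t
      rw [ht] at h2
      linarith
    · linarith
    · have h1 := hc.upper hh 0
      have h2 := hc'.lower (by linarith) t
      rw [ht] at h2
      linarith

end IsExpandingCurveWithParam

namespace IsGraphCurve

variable {R S : Circle} {u v φ ψ : ℝ → ℝ} {c d : ℝ → ℂ}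

theorem deriv_angle_of_pos (h : IsGraphCurve R u φ c) (h' : IsGraphCurve S v ψ d) {s t : ℝ}
    (hφ : 0 < deriv φ s) (hψ : 0 < deriv ψ t) :
    InnerProductGeometry.angle (deriv c s) (deriv d t) =
      InnerProductGeometry.angle (graphTangent R u (φ s)) (graphTangent S v (ψ t)) := by
  rw [h.deriv_eq, h'.deriv_eq, InnerProductGeometry.angle_smul_left_of_pos _ _ hφ,
    InnerProductGeometry.angle_smul_right_of_pos _ _ hψ]

theorem deriv_angle_of_neg_left (h : IsGraphCurve R u φ c) (h' : IsGraphCurve S v ψ d) {s t : ℝ}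
    (hφ : deriv φ s < 0) (hψ : 0 < deriv ψ t) :
    InnerProductGeometry.angle (deriv c s) (deriv d t) =
      InnerProductGeometry.angle (-graphTangent R u (φ s)) (graphTangent S v (ψ t)) := by
  rw [h.deriv_eq, h'.deriv_eq, InnerProductGeometry.angle_smul_left_of_neg _ _ hφ,
    InnerProductGeometry.angle_smul_right_of_pos _ _ hψ]

theorem deriv_angle_of_neg_right (h : IsGraphCurve R u φ c) (h' : IsGraphCurve S v ψ d) {s t : ℝ}
    (hφ : 0 < deriv φ s) (hψ : deriv ψ t < 0) :
    InnerProductGeometry.angle (deriv c s) (deriv d t) =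
      π - InnerProductGeometry.angle (graphTangent R u (φ s)) (graphTangent S v (ψ t)) := by
  rw [h.deriv_eq, h'.deriv_eq, InnerProductGeometry.angle_smul_left_of_pos _ _ hφ,
    InnerProductGeometry.angle_smul_right_of_neg _ _ hψ, InnerProductGeometry.angle_neg_right]

theorem deriv_angle_of_neg_neg (h : IsGraphCurve R u φ c) (h' : IsGraphCurve S v ψ d) {s t : ℝ}
    (hφ : deriv φ s < 0) (hψ : deriv ψ t < 0) :
    InnerProductGeometry.angle (deriv c s) (deriv d t) =
      π - InnerProductGeometry.angle (-graphTangent R u (φ s)) (graphTangent S v (ψ t)) := by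
  rw [h.deriv_eq, h'.deriv_eq, InnerProductGeometry.angle_smul_left_of_neg _ _ hφ,
    InnerProductGeometry.angle_smul_right_of_neg _ _ hψ, InnerProductGeometry.angle_neg_right]

/-- Transversal crossing: the height over either curve is strictly monotone along the other one,
in opposite directions. -/
theorem crossing (h : IsGraphCurve R u φ c) (h' : IsGraphCurve S v ψ d) {s t : ℝ}
    (hst : c s = d t) (hne : ∃ y, gap R u (graphPoint S v y) ≠ 0) :
    ((gapSlope S v R u (φ s) < 0 ∧ StrictAnti fun x => gap S v (graphPoint R u x)) ∧
      StrictMono fun y => gap R u (graphPoint S v y)) ∨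
    ((0 < gapSlope S v R u (φ s) ∧ StrictMono fun x => gap S v (graphPoint R u x)) ∧
      StrictAnti fun y => gap R u (graphPoint S v y)) := by
  have hp : graphPoint R u (φ s) = graphPoint S v (ψ t) := by rw [← h.eq, ← h'.eq, hst]
  have e := gapSlope_eq_neg hp
  have z : gap S v (graphPoint R u (φ s)) = 0 := by rw [hp, gap_graphPoint]
  have z' : gap R u (graphPoint S v (ψ t)) = 0 := by rw [← hp, gap_graphPoint]
  have hD := gap_graphPoint_dichotomy h.sol h'.sol R S
  rcases gap_graphPoint_dichotomy h'.sol h.sol S R with k | k | ⟨k, m⟩ | ⟨k, m⟩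
  · obtain ⟨y, hy⟩ := hne
    exact absurd (k y).1 hy
  · exact absurd z' (k _)
  · have hneg : gapSlope S v R u (φ s) < 0 := by rw [e]; exact neg_neg_of_pos (k _)
    rcases hD with q | q | ⟨q, m'⟩ | ⟨q, m'⟩
    · exact absurd (q _).2 hneg.ne
    · exact absurd z (q _)
    · exact absurd (q _) hneg.not_gt
    · exact .inl ⟨⟨hneg, m'⟩, m⟩
  · have hpos : 0 < gapSlope S v R u (φ s) := by rw [e]; exact neg_pos.2 (k _)
    rcases hD with q | q | ⟨q, m'⟩ | ⟨q, m'⟩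
    · exact absurd (q _).2 hpos.ne'
    · exact absurd z (q _)
    · exact .inr ⟨⟨hpos, m'⟩, m⟩
    · exact absurd (q _) hpos.not_gt

end IsGraphCurve

theorem strictMono_of_comp_strictMono {F φ : ℝ → ℝ} (hF : StrictMono F) (h : StrictMono (F ∘ φ)) :
    StrictMono φ := fun _ _ hab => hF.lt_iff_lt.1 (h hab)

theorem strictAnti_of_comp_strictMono {F φ : ℝ → ℝ} (hF : StrictAnti F) (h : StrictMono (F ∘ φ)) :
    StrictAnti φ := fun _ _ hab => hF.lt_iff_gt.1 (h hab)

namespace IsGraphCurve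

variable {R₁ R₂ R₃ : Circle} {u₁ u₂ u₃ φ₁ φ₂ φ₃ : ℝ → ℝ} {c₁ c₂ b : ℝ → ℂ} {s₁ s₂ t₁ t₂ : ℝ}

theorem deriv_pos_of_strictMono {R : Circle} {u φ : ℝ → ℝ} {c : ℝ → ℂ} (h : IsGraphCurve R u φ c)
    (hφ : StrictMono φ) (t : ℝ) : 0 < deriv φ t := by
  rcases h.mono_or_anti with ⟨k, -⟩ | ⟨-, k⟩
  · exact k t
  · exact absurd (hφ zero_lt_one) (k zero_lt_one).not_gt

theorem deriv_neg_of_strictAnti {R : Circle} {u φ : ℝ → ℝ} {c : ℝ → ℂ} (h : IsGraphCurve R u φ c)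
    (hφ : StrictAnti φ) (t : ℝ) : deriv φ t < 0 := by
  rcases h.mono_or_anti with ⟨-, k⟩ | ⟨k, -⟩
  · exact absurd (k zero_lt_one) (hφ zero_lt_one).not_gt
  · exact k t

/-- The direction of `b` in its frame determines the monotonicity of the other two parameters. If
`b` runs backwards, the first two curves exchange roles and each angle becomes its supplement, so
the difference of angles keeps its sign. -/
theorem triangle_area (h₁ : IsGraphCurve R₁ u₁ φ₁ c₁) (h₂ : IsGraphCurve R₂ u₂ φ₂ c₂)
    (h₃ : IsGraphCurve R₃ u₃ φ₃ b) (ha₁ : ApproachesHalfLine c₁) (ha₂ : ApproachesHalfLine c₂)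
    (h₁₂ : ∀ x, 0 < gap R₂ u₂ (graphPoint R₁ u₁ x))
    (h₂₁ : ∀ x, 0 < gap R₁ u₁ (graphPoint R₂ u₂ x))
    (hp₁ : c₁ s₁ = b t₁) (hp₂ : c₂ s₂ = b t₂) (ht : t₁ < t₂)
    (m₁ : StrictMono fun t => gap R₃ u₃ (c₁ t)) (m₂ : StrictMono fun t => gap R₃ u₃ (c₂ t)) :
    volume (triangle c₁ c₂ b s₁ s₂ t₁ t₂) < ⊤ ∧
      InnerProductGeometry.angle (deriv c₂ s₂) (deriv b t₂)
          - InnerProductGeometry.angle (deriv c₁ s₁) (deriv b t₁)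
        = 2 * volume.real (triangle c₁ c₂ b s₁ s₂ t₁ t₂) := by
  have e₁ : graphPoint R₁ u₁ (φ₁ s₁) = graphPoint R₃ u₃ (φ₃ t₁) := by rw [← h₁.eq, ← h₃.eq, hp₁]
  have e₂ : graphPoint R₂ u₂ (φ₂ s₂) = graphPoint R₃ u₃ (φ₃ t₂) := by rw [← h₂.eq, ← h₃.eq, hp₂]
  have z₁ : gap R₁ u₁ (graphPoint R₃ u₃ (φ₃ t₁)) = 0 := by rw [← e₁, gap_graphPoint]
  have z₂ : gap R₂ u₂ (graphPoint R₃ u₃ (φ₃ t₂)) = 0 := by rw [← e₂, gap_graphPoint]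
  have p₁ : 0 < gap R₁ u₁ (graphPoint R₃ u₃ (φ₃ t₂)) := e₂ ▸ h₂₁ _
  have p₂ : 0 < gap R₂ u₂ (graphPoint R₃ u₃ (φ₃ t₁)) := e₁ ▸ h₁₂ _
  have k₁ : (fun t => gap R₃ u₃ (c₁ t)) = (fun x => gap R₃ u₃ (graphPoint R₁ u₁ x)) ∘ φ₁ :=
    funext fun t => by rw [h₁.eq]; rfl
  have k₂ : (fun t => gap R₃ u₃ (c₂ t)) = (fun x => gap R₃ u₃ (graphPoint R₂ u₂ x)) ∘ φ₂ :=
    funext fun t => by rw [h₂.eq]; rfl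
  rw [k₁] at m₁
  rw [k₂] at m₂
  rcases h₃.mono_or_anti with ⟨-, n₃⟩ | ⟨-, n₃⟩
  · have hy : φ₃ t₁ < φ₃ t₂ := n₃ ht
    rcases h₁.crossing h₃ hp₁ ⟨_, p₁.ne'⟩ with ⟨⟨l₁, f₁⟩, g₁⟩ | ⟨-, g₁⟩
    swap
    · have := g₁ hy
      simp only at this
      linarith
    rcases h₂.crossing h₃ hp₂ ⟨_, p₂.ne'⟩ with ⟨-, g₂⟩ | ⟨⟨l₂, f₂⟩, g₂⟩
    · have := g₂ hy
      simp only at this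
      linarith
    have n₁ := strictAnti_of_comp_strictMono f₁ m₁
    have n₂ := strictMono_of_comp_strictMono f₂ m₂
    rw [h₂.deriv_angle_of_pos h₃ (h₂.deriv_pos_of_strictMono n₂ _)
      (h₃.deriv_pos_of_strictMono n₃ _), h₁.deriv_angle_of_neg_left h₃
      (h₁.deriv_neg_of_strictAnti n₁ _) (h₃.deriv_pos_of_strictMono n₃ _)]
    exact area_eq_angle_sub_angle h₁.sol h₂.sol h₃.sol hy e₁ e₂ h₁₂ h₂₁ f₁ f₂ g₁ g₂ l₁ l₂
      (h₁.approaches_of_strictAnti n₁ ha₁) (h₂.approaches_of_strictMono n₂ ha₂)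
      (by rw [h₁.image_Ici_of_strictAnti n₁, h₂.image_Ici_of_strictMono n₂,
        h₃.image_Icc_of_strictMono n₃])
  · have hy : φ₃ t₂ < φ₃ t₁ := n₃ ht
    rcases h₁.crossing h₃ hp₁ ⟨_, p₁.ne'⟩ with ⟨-, g₁⟩ | ⟨⟨l₁, f₁⟩, g₁⟩
    · have := g₁ hy
      simp only at this
      linarith
    rcases h₂.crossing h₃ hp₂ ⟨_, p₂.ne'⟩ with ⟨⟨l₂, f₂⟩, g₂⟩ | ⟨-, g₂⟩
    swap
    · have := g₂ hy
      simp only at this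
      linarith
    have n₁ := strictMono_of_comp_strictMono f₁ m₁
    have n₂ := strictAnti_of_comp_strictMono f₂ m₂
    rw [h₂.deriv_angle_of_neg_neg h₃ (h₂.deriv_neg_of_strictAnti n₂ _)
      (h₃.deriv_neg_of_strictAnti n₃ _), h₁.deriv_angle_of_neg_right h₃
      (h₁.deriv_pos_of_strictMono n₁ _) (h₃.deriv_neg_of_strictAnti n₃ _)]
    obtain ⟨hfin, harea⟩ := area_eq_angle_sub_angle h₂.sol h₁.sol h₃.sol hy e₂ e₁ h₂₁ h₁₂ f₂ f₁
      g₂ g₁ l₂ l₁ (h₂.approaches_of_strictAnti n₂ ha₂) (h₁.approaches_of_strictMono n₁ ha₁)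
      (Γ := c₁ '' Ici s₁ ∪ c₂ '' Ici s₂ ∪ b '' Icc t₁ t₂)
      (by rw [h₁.image_Ici_of_strictMono n₁, h₂.image_Ici_of_strictAnti n₂,
        h₃.image_Icc_of_strictAnti n₃, union_comm (graphPoint R₂ u₂ '' _)])
    refine ⟨hfin, ?_⟩
    rw [triangle, ← harea]
    ring

end IsGraphCurve

/-! ### Reduction to the normalized position -/

theorem mainTheorem2 (h₁ h₂ h₀ : ℝ) (c₁ c₂ c₀ b : ℝ → ℂ)
    (hc₁ : IsExpandingCurveWithParam h₁ c₁) (hc₂ : IsExpandingCurveWithParam h₂ c₂)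
    (hne : h₁ ≠ h₂)
    (hc₀ : IsExpandingCurveWithParam h₀ c₀) (R : Circle) (hR : R ≠ 1)
    (hb : ∀ t, b t = rotation R (c₀ t))
    (s₁ s₂ t₁ t₂ : ℝ) (hp₁ : c₁ s₁ = b t₁) (hp₂ : c₂ s₂ = b t₂) (ht : t₁ < t₂) :
    volume (triangle c₁ c₂ b s₁ s₂ t₁ t₂) < ⊤ ∧
      InnerProductGeometry.angle (deriv c₂ s₂) (deriv b t₂)
          - InnerProductGeometry.angle (deriv c₁ s₁) (deriv b t₁)
        = 2 * volume.real (triangle c₁ c₂ b s₁ s₂ t₁ t₂) := by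
  obtain ⟨R₁, u₁, φ₁, g₁⟩ := hc₁.exists_isGraphCurve
  obtain ⟨R₂, u₂, φ₂, g₂⟩ := hc₂.exists_isGraphCurve
  obtain ⟨R₀, u₃, φ₃, g₀⟩ := hc₀.exists_isGraphCurve
  have g₃ := g₀.rotation_comp R hb
  generalize R * R₀ = R₃ at g₃
  have a₁ := g₁.approachesHalfLine hc₁.asymptotic
  have a₂ := g₂.approachesHalfLine hc₂.asymptotic
  -- A common point would make the two curves coincide, and the image determines the parameter
  -- through its distance from the origin and its half-plane.
  have hdisj : ∀ s t, c₁ s ≠ c₂ t := by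
    intro s t hst
    have k₁ := (g₁.gap_eq_zero_or_ne_zero g₂ a₁ a₂).resolve_right fun k =>
      k (φ₁ s) (by rw [← g₁.eq, hst, g₂.gap_eq_zero])
    have k₂ := (g₂.gap_eq_zero_or_ne_zero g₁ a₂ a₁).resolve_right fun k =>
      k (φ₂ t) (by rw [← g₂.eq, ← hst, g₁.gap_eq_zero])
    exact hne (hc₁.param_eq_of_range_eq hc₂ ((g₁.range_subset_of_gap_eq_zero g₂ k₁).antisymm
      (g₂.range_subset_of_gap_eq_zero g₁ k₂)))
  obtain ⟨R₂, u₂, φ₂, g₂, h₁₂⟩ := g₂.exists_pos g₁.continuous fun t h0 => by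
    obtain ⟨x, hx⟩ := gap_eq_zero_iff.1 h0
    obtain ⟨s, rfl⟩ := g₂.surj x
    exact hdisj t s (by rw [g₂.eq, hx])
  obtain ⟨R₁, u₁, φ₁, g₁, h₂₁⟩ := g₁.exists_pos g₂.continuous fun t h0 => by
    obtain ⟨x, hx⟩ := gap_eq_zero_iff.1 h0
    obtain ⟨s, rfl⟩ := g₁.surj x
    exact hdisj s t (by rw [g₁.eq, hx])
  have h₁₂' : ∀ x, 0 < gap R₂ u₂ (graphPoint R₁ u₁ x) := fun x => by
    obtain ⟨s, rfl⟩ := g₁.surj x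
    rw [← g₁.eq]
    exact h₁₂ s
  have h₂₁' : ∀ x, 0 < gap R₁ u₁ (graphPoint R₂ u₂ x) := fun x => by
    obtain ⟨s, rfl⟩ := g₂.surj x
    rw [← g₂.eq]
    exact h₂₁ s
  have mono : ∀ {R : Circle} {u φ : ℝ → ℝ} {c : ℝ → ℂ} {s t : ℝ}, IsGraphCurve R u φ c →
      c s = b t → (∃ y, gap R u (b y) ≠ 0) →
      (StrictMono fun t => gap R₃ u₃ (c t)) ∨ StrictAnti fun t => gap R₃ u₃ (c t) := by
    intro R u φ c s t g hst ⟨y, hy⟩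
    have k : (fun t => gap R₃ u₃ (c t)) = (fun x => gap R₃ u₃ (graphPoint R u x)) ∘ φ :=
      funext fun t => by rw [g.eq]; rfl
    rw [k]
    rw [g₃.eq] at hy
    rcases g.crossing g₃ hst ⟨_, hy⟩ with ⟨⟨-, f⟩, -⟩ | ⟨⟨-, f⟩, -⟩ <;>
    rcases g.mono_or_anti with ⟨-, hφ⟩ | ⟨-, hφ⟩
    exacts [.inr (f.comp_strictMono hφ), .inl (f.comp hφ), .inl (f.comp hφ),
      .inr (f.comp_strictAnti hφ)]
  have M₁ := mono g₁ hp₁ ⟨t₂, (hp₂ ▸ h₂₁ s₂ : 0 < gap R₁ u₁ (b t₂)).ne'⟩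
  have M₂ := mono g₂ hp₂ ⟨t₁, (hp₁ ▸ h₁₂ s₁ : 0 < gap R₂ u₂ (b t₁)).ne'⟩
  have z₁ : gap R₃ u₃ (c₁ s₁) = 0 := by rw [hp₁, g₃.gap_eq_zero]
  have z₂ : gap R₃ u₃ (c₂ s₂) = 0 := by rw [hp₂, g₃.gap_eq_zero]
  -- Crossing `b` in opposite directions would leave the two ends on different sides of `b`,
  -- separated in height. If both cross downwards, reversing the frame of `b` makes both heights
  -- increase.
  rcases M₁ with m₁ | m₁ <;> rcases M₂ with m₂ | m₂
  · exact g₁.triangle_area g₂ g₃ a₁ a₂ h₁₂' h₂₁' hp₁ hp₂ ht m₁ m₂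
  · exact (a₁.not_separated a₂ g₃.sol (z₁ ▸ m₁ (lt_add_one s₁))
      ((eventually_ge_atTop (s₁ + 1)).mono fun t ht => m₁.monotone ht)
      ((eventually_ge_atTop s₂).mono fun t ht => (m₂.antitone ht).trans z₂.le)).elim
  · exact (a₂.not_separated a₁ g₃.sol (z₂ ▸ m₂ (lt_add_one s₂))
      ((eventually_ge_atTop (s₂ + 1)).mono fun t ht => m₂.monotone ht)
      ((eventually_ge_atTop s₁).mono fun t ht => (m₁.antitone ht).trans z₁.le)).elim
  · refine g₁.triangle_area g₂ g₃.flip a₁ a₂ h₁₂' h₂₁' hp₁ hp₂ ht ?_ ?_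
    · simpa only [gap_flip] using m₁.neg
    · simpa only [gap_flip] using m₂.neg
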